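/- A semideterministic relay channel consists of finite nonempty alphabets $\mathcal X,\mathcal X_r,\mathcal Y,\mathcal Z$, a conditional pmf $p_{Y|X,X_r}(y|x,x_r)$ and a function $z:\mathcal X\times\mathcal X_r\to\mathcal Z$. The source sends $X_i$, the relay sends $X_{r,i}$ and receives $Z_i=z(X_i,X_{r,i})$, and the destination receives $Y_i$; the channel is memoryless. An $(n,2^{nR},\epsilon)$ code consists of source encoding functions $x_i:[1:2^{nR}]\to\mathcal X$ and relay encoding functions $x_{r,i}:\mathcal Z^{i-1}\to\mathcal X_r$, $1\le i\le n$, and a decoding function $\hat m:\mathcal Y^n\to[1:2^{nR}]$, such that $\Pr\{\hat m(Y^n)\ne M\}\le\epsilon$ when the message $M$ is uniformly distributed on $[1:2^{nR}]=\{1,\dots,\lfloor 2^{nR}\rfloor\}$ and $X_i=x_i(M)$, $X_{r,i}=x_{r,i}(Z^{i-1})$. A rate $R\ge 0$ is achievable if for every $\epsilon>0$ there exists an $(n,2^{nR},\epsilon)$ code for all sufficiently large $n$, and the capacity $C$ is the supremum of the achievable rates. **Theorem.** The capacity of the semideterministic relay channel is finite and is given by $$C=\max_{p_{X,X_r}(x,x_r)}\min\left\{I(X,X_r;Y),\;H(Z|X_r)+I(X;Y|X_r,Z)\right\},$$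 where the maximum, which is attained, is over all pmfs $p_{X,X_r}$ on $\mathcal X\times\mathcal X_r$, the random variables $(X,X_r,Y)$ have joint pmf $p_{X,X_r}(x,x_r)\,p_{Y|X,X_r}(y|x,x_r)$, $Z=z(X,X_r)$, and entropies and mutual informations are in bits (logarithms to base 2). -/

import Mathlib

noncomputable section

namespace FiniteInfo

/-! Information measures (in bits) of random variables on a finite sample space `Ω`
carrying the pmf `P`; random variables are functions on `Ω`. -/

variable {Ω A B C : Type*} [Fintype Ω] [Fintype A] [Fintype B] [Fintype C]

open Classical in
/-- The pmf of the random variable `f`: `law P f a = Pr(f = a)`. -/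
def law (P : Ω → ℝ) (f : Ω → A) (a : A) : ℝ :=
  ∑ ω, if f ω = a then P ω else 0

/-- Conditional entropy `H(f | g) = - ∑ p(a, b) log₂ p(a | b)`. -/
def condEntropy (P : Ω → ℝ) (f : Ω → A) (g : Ω → B) : ℝ :=
  -∑ a, ∑ b, law P (fun ω => (f ω, g ω)) (a, b) *
    Real.logb 2 (law P (fun ω => (f ω, g ω)) (a, b) / law P g b)

/-- Mutual information `I(f ; g) = ∑ p(a, b) log₂ (p(a, b) / (p(a) p(b)))`. -/
def mutualInfo (P : Ω → ℝ) (f : Ω → A) (g : Ω → B) : ℝ :=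
  ∑ a, ∑ b, law P (fun ω => (f ω, g ω)) (a, b) *
    Real.logb 2 (law P (fun ω => (f ω, g ω)) (a, b) / (law P f a * law P g b))

/-- Conditional mutual information `I(f ; g | h) = H(f | h) - H(f | g, h)`. -/
def condMutualInfo (P : Ω → ℝ) (f : Ω → A) (g : Ω → B) (h : Ω → C) : ℝ :=
  condEntropy P f h - condEntropy P f (fun ω => (g ω, h ω))

end FiniteInfo

/-- A (discrete memoryless) semideterministic relay channel: `W x xr` is the pmf of the
destination's output given the source input `x` and the relay input `xr`, and the relay
observes `z x xr`. -/
structure SemidetRelayChannel (X Xr Y Z : Type*) [Fintype Y] where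
  W : X → Xr → Y → ℝ
  W_nonneg : ∀ x xr y, 0 ≤ W x xr y
  W_sum : ∀ x xr, ∑ y, W x xr y = 1
  z : X → Xr → Z

/-- A code of block length `n` with `M` messages. At time `i` the relay uses only its strictly
past observations. -/
structure RelayCode (X Xr Y Z : Type*) (n M : ℕ) where
  enc : Fin M → Fin n → X
  relay : (i : Fin n) → (Fin i.val → Z) → Xr
  dec : (Fin n → Y) → Fin M

namespace SemidetRelayChannel

variable {X Xr Y Z : Type*} [Fintype Y]

/-- The symbol received by the relay at time `i` when message `m` is sent. -/
def relayObs (ch : SemidetRelayChannel X Xr Y Z) {n M : ℕ} (c : RelayCode X Xr Y Z n M)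
    (m : Fin M) (i : Fin n) : Z :=
  ch.z (c.enc m i)
    (c.relay i (fun j => relayObs ch c m ⟨j.val, j.isLt.trans i.isLt⟩))
termination_by i.val
decreasing_by exact j.isLt

/-- The symbol sent by the relay at time `i` when message `m` is sent. -/
def relayInput (ch : SemidetRelayChannel X Xr Y Z) {n M : ℕ} (c : RelayCode X Xr Y Z n M)
    (m : Fin M) (i : Fin n) : Xr :=
  c.relay i (fun j => ch.relayObs c m ⟨j.val, j.isLt.trans i.isLt⟩)

/-- The conditional probability, given that message `m` is sent, that the destination
receives `y`. -/
def outputProb (ch : SemidetRelayChannel X Xr Y Z) {n M : ℕ} (c : RelayCode X Xr Y Z n M)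
    (m : Fin M) (y : Fin n → Y) : ℝ :=
  ∏ i, ch.W (c.enc m i) (ch.relayInput c m i) (y i)

/-- The probability that the decoded message differs from the transmitted one, the latter being
uniformly distributed. -/
def errorProb (ch : SemidetRelayChannel X Xr Y Z) {n M : ℕ} (c : RelayCode X Xr Y Z n M) : ℝ :=
  (∑ m : Fin M, ∑ y : Fin n → Y, if c.dec y ≠ m then ch.outputProb c m y else 0) / M

/-- The rate `R ≥ 0` is achievable: for every `ε > 0` and all sufficiently large `n` there is a
code of length `n` with message set `[1 : 2^(nR)]` and error probability at most `ε`. -/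
def Achievable (ch : SemidetRelayChannel X Xr Y Z) (R : ℝ) : Prop :=
  0 ≤ R ∧ ∀ ε : ℝ, 0 < ε → ∃ N : ℕ, ∀ n : ℕ, N ≤ n →
    ∃ c : RelayCode X Xr Y Z n ⌊(2 : ℝ) ^ ((n : ℝ) * R)⌋₊, ch.errorProb c ≤ ε

/-- The capacity: the supremum of the achievable rates. -/
def capacity (ch : SemidetRelayChannel X Xr Y Z) : ℝ :=
  sSup {R | ch.Achievable R}

/-- The joint pmf of `(X, X_r, Y)` when `(X, X_r)` has pmf `p`. -/
def jointPmf (ch : SemidetRelayChannel X Xr Y Z) (p : X × Xr → ℝ) (ω : X × Xr × Y) : ℝ :=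
  p (ω.1, ω.2.1) * ch.W ω.1 ω.2.1 ω.2.2

/-- `min {I(X, X_r; Y), H(Z | X_r) + I(X; Y | X_r, Z)}` for the input pmf `p`, where
`Z = z(X, X_r)`. -/
def rateBound [Fintype X] [Fintype Xr] [Fintype Z]
    (ch : SemidetRelayChannel X Xr Y Z) (p : X × Xr → ℝ) : ℝ :=
  let P := ch.jointPmf p
  let vX : X × Xr × Y → X := fun ω => ω.1
  let vXr : X × Xr × Y → Xr := fun ω => ω.2.1
  let vY : X × Xr × Y → Y := fun ω => ω.2.2
  let vZ : X × Xr × Y → Z := fun ω => ch.z ω.1 ω.2.1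
  min (FiniteInfo.mutualInfo P (fun ω => (vX ω, vXr ω)) vY)
    (FiniteInfo.condEntropy P vZ vXr +
      FiniteInfo.condMutualInfo P vX vY (fun ω => (vXr ω, vZ ω)))

end SemidetRelayChannel

end

/-! Since Z is a function of the inputs, the second term of the bound equals H(Y,Z|X_r) -
H(Y|X,X_r). So both terms are expected log-likelihood ratios of the channel law, one against P(y),
the other against P(z,y|x_r) (`rateBound_eq_min_divergence`), and both halves of the proof work with
these ratios directly.

Converse (`log_card_le_rateBound`). Let p be the input pmf of the code averaged over messages and
time. Gibbs' inequality against a product density Q_m(y), boosted by the factor M where the decoder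
answers m, bounds (1 - P_e) log M by n times the divergence plus one bit, provided that
Q_{dec(y)}(y) sums to at most 1 over y. For P(y) the density does not depend on m. For P(z,y|x_r) it
depends on m only through the relay observations, which determine the relay inputs; the sum over all
observation sequences is at most 1 by causality.

Achievability (`achievable_of_lt_rateBound`). The relay does not decode. Its state in a block is a
random hash of its previous state and of its observations in the previous block, and selects its
codeword. The source, which can compute all of this, superposes a codeword indexed by message part
and state. The destination decodes backwards: the state of the next block is the hash that helps to
find the message part and the state of the present one. With T hash values and typicality threshold
t, a wrong state must look typical and also collide (probability 1/(T t)); a wrong message part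
under the right state must repeat the relay observation and look typical, or collide (at most 1/t +
1/T). With M message parts per block and T = M^2 these errors vanish for log M below log t. Two
final blocks without message shrink the state from M^2 to M to 1 values, at a rate loss that
vanishes as the number of blocks grows. -/

open Finset

noncomputable section

set_option linter.unusedSectionVars false

namespace FiniteInfo

/-! ### Sums against product weights. -/

section ProductSums

variable {ι A : Type*} [Fintype ι] [DecidableEq ι] [Fintype A]

theorem sum_prod_mul_apply (w : ι → A → ℝ) (hw : ∀ k, ∑ a, w k a = 1) (i : ι) (g : A → ℝ) :
    ∑ c : ι → A, (∏ k, w k (c k)) * g (c i) = ∑ a, w i a * g a := by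
  have h1 : ∀ c : ι → A, (∏ k, w k (c k)) * g (c i)
      = ∏ k, w k (c k) * (if k = i then g (c k) else 1) := by
    intro c
    rw [prod_mul_distrib]
    simp
  have h2 : ∀ k, ∑ a, w k a * (if k = i then g a else 1)
      = if k = i then ∑ a, w i a * g a else 1 := by
    intro k
    by_cases h : k = i
    · subst h; simp
    · simp [h, hw]
  simp_rw [h1]
  rw [← Fintype.prod_sum (fun k a => w k a * (if k = i then g a else 1))]
  simp_rw [h2]
  simp

theorem sum_prod_eq_one (w : ι → A → ℝ) (hw : ∀ k, ∑ a, w k a = 1) :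
    ∑ c : ι → A, ∏ k, w k (c k) = 1 := by
  rw [← Fintype.prod_sum]
  simp [hw]

/-- A function of two coordinates is a combination of products of indicators, which reduces the
claim to the factorised case `key`. -/
theorem sum_prod_mul_apply_two (w : ι → A → ℝ) (hw : ∀ k, ∑ a, w k a = 1) {i j : ι} (hij : i ≠ j)
    (G : A → A → ℝ) :
    ∑ c : ι → A, (∏ k, w k (c k)) * G (c i) (c j) = ∑ a, ∑ b, w i a * w j b * G a b := by
  classical
  have key : ∀ g h : A → ℝ, ∑ c : ι → A, (∏ k, w k (c k)) * (g (c i) * h (c j))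
      = (∑ a, w i a * g a) * (∑ b, w j b * h b) := by
    intro g h
    have h1 : ∀ c : ι → A, (∏ k, w k (c k)) * (g (c i) * h (c j))
        = ∏ k, w k (c k) * ((if k = i then g (c k) else 1) * (if k = j then h (c k) else 1)) := by
      intro c
      rw [prod_mul_distrib, prod_mul_distrib]
      simp
    have h2 : ∀ k, ∑ a, w k a * ((if k = i then g a else 1) * (if k = j then h a else 1))
        = (if k = i then ∑ a, w i a * g a else 1) * (if k = j then ∑ b, w j b * h b else 1) := by
      intro k
      by_cases hk : k = i
      · subst hk; simp [hij]
      · by_cases hk' : k = j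
        · subst hk'; simp [hk]
        · simp [hk, hk', hw]
    simp_rw [h1]
    rw [← Fintype.prod_sum
      (fun k a => w k a * ((if k = i then g a else 1) * (if k = j then h a else 1)))]
    simp_rw [h2]
    rw [prod_mul_distrib]
    simp
  have h3 : ∀ c : ι → A, (∏ k, w k (c k)) * G (c i) (c j)
      = ∑ a, ∑ b, G a b * ((∏ k, w k (c k)) *
        ((if c i = a then 1 else 0) * (if c j = b then 1 else 0))) := by
    intro c
    rw [sum_eq_single (c i) (by intro a _ h; simp [h.symm]) (by simp),
      sum_eq_single (c j) (by intro a _ h; simp [h.symm]) (by simp)]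
    simp [mul_comm]
  simp_rw [h3]
  rw [sum_comm]
  refine sum_congr rfl fun a _ => ?_
  rw [sum_comm]
  refine sum_congr rfl fun b _ => ?_
  rw [← mul_sum, key (fun x => if x = a then 1 else 0) (fun x => if x = b then 1 else 0)]
  simp [mul_comm]

/-- A function whose weighted average is at most `C` is at most `C` somewhere. -/
theorem exists_le_of_weighted_sum_le {Ω : Type*} [Fintype Ω] (w : Ω → ℝ) (hw : ∀ ω, 0 ≤ w ω)
    (hs : ∑ ω, w ω = 1) (g : Ω → ℝ) {C : ℝ} (h : ∑ ω, w ω * g ω ≤ C) : ∃ ω, g ω ≤ C := by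
  by_contra! hcon
  obtain ⟨ω₀, -, h₀⟩ : ∃ ω ∈ (univ : Finset Ω), w ω ≠ 0 := by
    refine exists_ne_zero_of_sum_ne_zero (by rw [hs]; norm_num)
  have : ∑ ω, w ω * C < ∑ ω, w ω * g ω :=
    sum_lt_sum (fun ω _ => mul_le_mul_of_nonneg_left (hcon ω).le (hw ω))
      ⟨ω₀, mem_univ _, mul_lt_mul_of_pos_left (hcon ω₀) ((hw ω₀).lt_of_ne' h₀)⟩
  rw [← sum_mul, hs, one_mul] at this
  linarith

end ProductSums

/-- No earlier factor depends on the last coordinate, so it can be summed out first; induct on `n`.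
This is how the causality of the relay enters the converse. -/
theorem sum_causal_prod_le_one {A : Type*} [Fintype A] :
    ∀ {n : ℕ} (k : (i : Fin n) → (Fin i.val → A) → A → ℝ) (_ : ∀ i p a, 0 ≤ k i p a)
      (_ : ∀ i p, ∑ a, k i p a ≤ 1),
      ∑ c : Fin n → A, ∏ i, k i (fun j => c ⟨j.val, j.isLt.trans i.isLt⟩) (c i) ≤ 1
  | 0, _, _, _ => by simp
  | n + 1, k, h0, h1 => by
    rw [← (Fin.snocEquiv (fun _ => A)).sum_comp, Fintype.sum_prod_type, sum_comm]
    refine le_trans (sum_le_sum fun c _ => ?_) (sum_causal_prod_le_one (n := n)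
      (fun i => k i.castSucc) (fun i => h0 i.castSucc) (fun i => h1 i.castSucc))
    have : ∀ a : A, ∏ i : Fin (n + 1), k i (fun j => (Fin.snocEquiv (fun _ => A)) (a, c)
          ⟨j.val, j.isLt.trans i.isLt⟩) ((Fin.snocEquiv (fun _ => A)) (a, c) i)
        = (∏ i : Fin n, k i.castSucc (fun j => c ⟨j.val, j.isLt.trans i.isLt⟩) (c i))
          * k (Fin.last n) c a := by
      intro a
      rw [Fin.prod_univ_castSucc]
      congr 1
      · refine prod_congr rfl fun i _ => ?_
        congr 1
        · funext j
          exact Fin.snoc_castSucc (α := fun _ => A) (i := ⟨j.val, j.isLt.trans i.isLt⟩) ..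
        · exact Fin.snoc_castSucc (α := fun _ => A) ..
      · congr 1
        · funext j
          exact Fin.snoc_castSucc (α := fun _ => A) (i := j) ..
        · exact Fin.snoc_last (α := fun _ => A) ..
    simp_rw [this]
    rw [← mul_sum]
    exact mul_le_of_le_one_right (prod_nonneg fun i _ => h0 _ _ _) (h1 _ _)

/-- Gibbs' inequality against a subprobability `T`. -/
theorem sum_mul_log_div_nonpos {Ω : Type*} [Fintype Ω] (P T : Ω → ℝ) (hP : ∀ ω, 0 ≤ P ω)
    (hT : ∀ ω, 0 ≤ T ω) (hPs : ∑ ω, P ω = 1) (hTs : ∑ ω, T ω ≤ 1)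
    (hac : ∀ ω, 0 < P ω → 0 < T ω) : ∑ ω, P ω * Real.log (T ω / P ω) ≤ 0 := by
  have : ∀ ω, P ω * Real.log (T ω / P ω) ≤ T ω - P ω := by
    intro ω
    rcases (hP ω).eq_or_lt with h | h
    · rw [← h]; simpa using hT ω
    · have h1 := Real.log_le_sub_one_of_pos (div_pos (hac ω h) h)
      calc P ω * Real.log (T ω / P ω) ≤ P ω * (T ω / P ω - 1) :=
            mul_le_mul_of_nonneg_left h1 h.le
        _ = T ω - P ω := by field_simp
  calc _ ≤ ∑ ω, (T ω - P ω) := sum_le_sum fun ω _ => this ω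
    _ ≤ 0 := by rw [sum_sub_distrib]; linarith

/-- The exponential moment of a random variable with positive mean is below one for some small
negative tilt. -/
theorem exists_sum_mul_exp_lt_one {Ω : Type*} [Fintype Ω] (P f : Ω → ℝ) (hP : ∀ ω, 0 ≤ P ω)
    (hPs : ∑ ω, P ω = 1) (hf : 0 < ∑ ω, P ω * f ω) :
    ∃ l : ℝ, 0 < l ∧ ∑ ω, P ω * Real.exp (-(l * f ω)) < 1 := by
  set m := ∑ ω, P ω * f ω with hm
  set G := 1 + ∑ ω, |f ω| with hG
  have hG1 : 1 ≤ G := by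
    have : 0 ≤ ∑ ω, |f ω| := sum_nonneg fun _ _ => abs_nonneg _
    linarith
  have hfG : ∀ ω, |f ω| ≤ G := fun ω => by
    have := single_le_sum (f := fun ω => |f ω|) (fun i _ => abs_nonneg _) (mem_univ ω)
    linarith
  -- The bound `1 / G` gives access to e^u ≤ 1 + u + u² for |u| ≤ 1; the bound `m / (2 * G ^ 2)`
  -- keeps the quadratic remainder below the linear gain `l * m`.
  obtain ⟨l, hl0, hl1, hl2⟩ : ∃ l : ℝ, 0 < l ∧ l * G ≤ 1 ∧ l * G ^ 2 < m := by
    refine ⟨min (1 / G) (m / (2 * G ^ 2)), by positivity, ?_, ?_⟩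
    · calc _ ≤ 1 / G * G := by gcongr; exact min_le_left _ _
        _ = 1 := by field_simp
    · calc _ ≤ m / (2 * G ^ 2) * G ^ 2 := by gcongr; exact min_le_right _ _
        _ = m / 2 := by field_simp
        _ < m := by linarith
  refine ⟨l, hl0, ?_⟩
  have hb : ∀ ω, Real.exp (-(l * f ω)) ≤ 1 - l * f ω + (l * G) ^ 2 := by
    intro ω
    have hx : |-(l * f ω)| ≤ l * G := by
      rw [abs_neg, abs_mul, abs_of_pos hl0]; exact mul_le_mul_of_nonneg_left (hfG ω) hl0.le
    have h := (abs_le.1 (Real.abs_exp_sub_one_sub_id_le (hx.trans hl1))).2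
    have : (-(l * f ω)) ^ 2 ≤ (l * G) ^ 2 := by
      rw [← sq_abs]; exact pow_le_pow_left₀ (abs_nonneg _) hx 2
    linarith
  calc _ ≤ ∑ ω, P ω * (1 - l * f ω + (l * G) ^ 2) :=
        sum_le_sum fun ω _ => mul_le_mul_of_nonneg_left (hb ω) (hP ω)
    _ = ∑ ω, (P ω * (1 + (l * G) ^ 2) - l * (P ω * f ω)) := sum_congr rfl fun ω _ => by ring
    _ = 1 + l * (l * G ^ 2) - l * m := by
        rw [sum_sub_distrib, ← sum_mul, ← mul_sum, hPs]; ring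
    _ < 1 := by nlinarith

/-! ### Laws and entropies as sums over the sample space. -/

variable {Ω A B C : Type*} [Fintype Ω] [Fintype A] [Fintype B] [Fintype C]

theorem sum_law_mul (P : Ω → ℝ) (f : Ω → A) (G : A → ℝ) :
    ∑ a, law P f a * G a = ∑ ω, P ω * G (f ω) := by
  classical
  simp_rw [law, sum_mul, ite_mul, zero_mul]
  rw [sum_comm]
  refine sum_congr rfl fun ω _ => ?_
  rw [sum_eq_single (f ω) (fun a _ h => if_neg h.symm) (by simp), if_pos rfl]

theorem le_law {P : Ω → ℝ} (hP : ∀ ω, 0 ≤ P ω) (f : Ω → A) (ω : Ω) : P ω ≤ law P f (f ω) := by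
  classical
  have := single_le_sum (f := fun ω' => if f ω' = f ω then P ω' else 0)
    (fun i _ => by split_ifs <;> simp [hP]) (mem_univ ω)
  simpa [law] using this

theorem law_apply_of_injective (P : Ω → ℝ) {f : Ω → A} (hf : Function.Injective f) (ω : Ω) :
    law P f (f ω) = P ω := by
  classical
  rw [law, sum_eq_single ω (fun b _ h => if_neg fun e => h (hf e)) (by simp), if_pos rfl]

theorem law_equiv (P : Ω → ℝ) (f : Ω → A) (e : A ≃ B) (a : A) :
    law P (fun ω => e (f ω)) (e a) = law P f a := by
  unfold law
  refine sum_congr rfl fun ω _ => ?_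
  by_cases h : f ω = a
  · rw [if_pos h, if_pos (congrArg e h)]
  · rw [if_neg h, if_neg fun h' => h (e.injective h')]

theorem condEntropy_eq_sum (P : Ω → ℝ) (f : Ω → A) (g : Ω → B) :
    condEntropy P f g = -∑ ω, P ω *
      Real.logb 2 (law P (fun ω => (f ω, g ω)) (f ω, g ω) / law P g (g ω)) := by
  rw [condEntropy, ← sum_law_mul P (fun ω => (f ω, g ω)) (fun ab =>
    Real.logb 2 (law P (fun ω => (f ω, g ω)) ab / law P g ab.2)), Fintype.sum_prod_type]

theorem mutualInfo_eq_sum (P : Ω → ℝ) (f : Ω → A) (g : Ω → B) :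
    mutualInfo P f g = ∑ ω, P ω * Real.logb 2
      (law P (fun ω => (f ω, g ω)) (f ω, g ω) / (law P f (f ω) * law P g (g ω))) := by
  rw [mutualInfo, ← sum_law_mul P (fun ω => (f ω, g ω)) (fun ab =>
    Real.logb 2 (law P (fun ω => (f ω, g ω)) ab / (law P f ab.1 * law P g ab.2))),
    Fintype.sum_prod_type]

/-- Shannon entropy in bits. -/
def entropy (P : Ω → ℝ) (f : Ω → A) : ℝ := ∑ a, Real.negMulLog (law P f a) / Real.log 2

theorem entropy_eq_sum (P : Ω → ℝ) (f : Ω → A) :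
    entropy P f = -∑ ω, P ω * Real.logb 2 (law P f (f ω)) := by
  rw [← sum_law_mul P f (fun a => Real.logb 2 (law P f a)), entropy, ← sum_neg_distrib]
  exact sum_congr rfl fun a _ => by rw [Real.negMulLog, Real.logb]; ring

theorem condEntropy_eq_entropy_sub {P : Ω → ℝ} (hP : ∀ ω, 0 ≤ P ω) (f : Ω → A) (g : Ω → B) :
    condEntropy P f g = entropy P (fun ω => (f ω, g ω)) - entropy P g := by
  rw [condEntropy_eq_sum, entropy_eq_sum, entropy_eq_sum, neg_sub_neg, ← sum_sub_distrib,
    ← sum_neg_distrib]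
  refine sum_congr rfl fun ω _ => ?_
  rcases (hP ω).eq_or_lt with h | h
  · simp [← h]
  · have h1 := h.trans_le (le_law hP (fun ω => (f ω, g ω)) ω)
    have h2 := h.trans_le (le_law hP g ω)
    rw [Real.logb_div h1.ne' h2.ne']; ring

theorem mutualInfo_eq_entropy {P : Ω → ℝ} (hP : ∀ ω, 0 ≤ P ω) (f : Ω → A) (g : Ω → B) :
    mutualInfo P f g = entropy P f + entropy P g - entropy P (fun ω => (f ω, g ω)) := by
  rw [mutualInfo_eq_sum, entropy_eq_sum, entropy_eq_sum, entropy_eq_sum, sub_neg_eq_add,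
    ← neg_add, neg_add_eq_sub, ← sum_add_distrib, ← sum_sub_distrib]
  refine sum_congr rfl fun ω _ => ?_
  rcases (hP ω).eq_or_lt with h | h
  · simp [← h]
  · have h1 := h.trans_le (le_law hP (fun ω => (f ω, g ω)) ω)
    have h2 := h.trans_le (le_law hP g ω)
    have h3 := h.trans_le (le_law hP f ω)
    rw [Real.logb_div h1.ne' (mul_pos h3 h2).ne', Real.logb_mul h3.ne' h2.ne']; ring

/-- Continuity survives at vanishing masses because `Real.negMulLog` is continuous at 0; the
logarithms of ratios in the original definitions do not show this. -/
theorem continuous_entropy {T : Type*} [TopologicalSpace T] {P : T → Ω → ℝ}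
    (hP : ∀ ω, Continuous fun t => P t ω) (f : Ω → A) : Continuous fun t => entropy (P t) f := by
  classical
  refine continuous_finsetSum _ fun a _ => (Real.continuous_negMulLog.comp ?_).div_const _
  refine continuous_finsetSum _ fun ω _ => ?_
  split_ifs
  · exact hP ω
  · exact continuous_const

end FiniteInfo

/-! ### The rate bound as a minimum of two divergences, and its maximum. -/

namespace SemidetRelayChannel

open FiniteInfo

variable {X Xr Y Z : Type*} [Fintype X] [Fintype Xr] [Fintype Y]
  (ch : SemidetRelayChannel X Xr Y Z)

/-- The pmf of the destination's output. -/
def outLaw (p : X × Xr → ℝ) (y : Y) : ℝ := ∑ u : X × Xr, p u * ch.W u.1 u.2 y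

/-- The pmf of the relay input. -/
def relayLaw (p : X × Xr → ℝ) (xr : Xr) : ℝ := ∑ x, p (x, xr)

open Classical in
/-- The joint pmf of the relay observation and the destination's output given the relay input. -/
def condLaw (p : X × Xr → ℝ) (xr : Xr) (z : Z) (y : Y) : ℝ :=
  (∑ x, if ch.z x xr = z then p (x, xr) * ch.W x xr y else 0) / relayLaw p xr

/-- The expected logarithm of the ratio of the channel law to a reference density `D`. -/
def divergence (p : X × Xr → ℝ) (D : X → Xr → Y → ℝ) : ℝ :=
  ∑ ω : X × Xr × Y, ch.jointPmf p ω *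
    Real.logb 2 (ch.W ω.1 ω.2.1 ω.2.2 / D ω.1 ω.2.1 ω.2.2)

variable {ch} {p : X × Xr → ℝ}

theorem jointPmf_nonneg (hp : ∀ u, 0 ≤ p u) (ω : X × Xr × Y) : 0 ≤ ch.jointPmf p ω :=
  mul_nonneg (hp _) (ch.W_nonneg _ _ _)

theorem sum_jointPmf_mul (p : X × Xr → ℝ) (G : X × Xr × Y → ℝ) :
    ∑ ω, ch.jointPmf p ω * G ω = ∑ u : X × Xr, p u * ∑ y, ch.W u.1 u.2 y * G (u.1, u.2, y) := by
  rw [Fintype.sum_prod_type, Fintype.sum_prod_type]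
  refine sum_congr rfl fun x _ => ?_
  rw [Fintype.sum_prod_type]
  refine sum_congr rfl fun xr _ => ?_
  rw [mul_sum]
  exact sum_congr rfl fun y _ => by simp [jointPmf, mul_assoc]

theorem law_input {A : Type*} (g : X × Xr → A) (a : A) :
    law (ch.jointPmf p) (fun ω => g (ω.1, ω.2.1)) a = law p g a := by
  classical
  have := sum_jointPmf_mul (ch := ch) p (fun ω => if g (ω.1, ω.2.1) = a then 1 else 0)
  simp only [mul_ite, mul_one, mul_zero] at this
  rw [law, this, law]
  refine sum_congr rfl fun u _ => ?_
  split_ifs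
  · rw [ch.W_sum, mul_one]
  · simp

theorem law_output (y : Y) : law (ch.jointPmf p) (fun ω => ω.2.2) y = ch.outLaw p y := by
  classical
  have := sum_jointPmf_mul (ch := ch) p (fun ω => if ω.2.2 = y then 1 else 0)
  simp only [mul_ite, mul_one, mul_zero] at this
  rw [law, this, outLaw]
  exact sum_congr rfl fun u _ => by simp

theorem law_relay (xr : Xr) :
    law (ch.jointPmf p) (fun ω => ω.2.1) xr = relayLaw p xr := by
  classical
  rw [law_input (fun u => u.2), law, relayLaw, Fintype.sum_prod_type]
  exact sum_congr rfl fun x _ => by simp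

theorem law_output_relay (xr : Xr) (z : Z) (y : Y) :
    law (ch.jointPmf p) (fun ω => (ω.2.2, ω.2.1, ch.z ω.1 ω.2.1)) (y, xr, z)
      / relayLaw p xr = ch.condLaw p xr z y := by
  classical
  rw [condLaw, law, Fintype.sum_prod_type]
  congr 1
  refine sum_congr rfl fun x _ => ?_
  rw [sum_eq_single (xr, y)]
  · simp [jointPmf]
  · rintro ⟨xr', y'⟩ - h
    refine if_neg fun e => h ?_
    simp only [Prod.mk.injEq] at e ⊢
    exact ⟨e.2.1, e.1⟩
  · simp

theorem outLaw_pos (hp : ∀ u, 0 ≤ p u) {x : X} {xr : Xr} {y : Y} (h : 0 < p (x, xr))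
    (hW : 0 < ch.W x xr y) : 0 < ch.outLaw p y :=
  (mul_pos h hW).trans_le (single_le_sum (f := fun u : X × Xr => p u * ch.W u.1 u.2 y)
    (fun u _ => mul_nonneg (hp u) (ch.W_nonneg _ _ _)) (mem_univ (x, xr)))

theorem relayLaw_pos (hp : ∀ u, 0 ≤ p u) {x : X} {xr : Xr} (h : 0 < p (x, xr)) :
    0 < relayLaw p xr :=
  h.trans_le (single_le_sum (f := fun x => p (x, xr)) (fun _ _ => hp _) (mem_univ x))

theorem condLaw_pos (hp : ∀ u, 0 ≤ p u) {x : X} {xr : Xr} {y : Y} (h : 0 < p (x, xr))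
    (hW : 0 < ch.W x xr y) : 0 < ch.condLaw p xr (ch.z x xr) y := by
  classical
  refine div_pos ?_ (relayLaw_pos hp h)
  have := single_le_sum (f := fun x' => if ch.z x' xr = ch.z x xr then
    p (x', xr) * ch.W x' xr y else 0) (fun u _ => by
      split_ifs
      · exact mul_nonneg (hp _) (ch.W_nonneg _ _ _)
      · exact le_rfl) (mem_univ x)
  simp only [if_true] at this
  exact (mul_pos h hW).trans_le this

variable [Fintype Z]

/-- Both terms of the rate bound are relative entropies with respect to the channel law. -/
theorem rateBound_eq_min_divergence (hp : ∀ u, 0 ≤ p u) :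
    ch.rateBound p = min (ch.divergence p fun _ _ y => ch.outLaw p y)
      (ch.divergence p fun x xr y => ch.condLaw p xr (ch.z x xr) y) := by
  have hP := jointPmf_nonneg (ch := ch) hp
  have key : ∀ ω : X × Xr × Y, 0 < ch.jointPmf p ω →
      0 < p (ω.1, ω.2.1) ∧ 0 < ch.W ω.1 ω.2.1 ω.2.2 := by
    intro ω h
    rw [jointPmf] at h
    have h1 : p (ω.1, ω.2.1) ≠ 0 := fun e => by simp [e] at h
    have h2 : ch.W ω.1 ω.2.1 ω.2.2 ≠ 0 := fun e => by simp [e] at h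
    exact ⟨(hp _).lt_of_ne' h1, (ch.W_nonneg _ _ _).lt_of_ne' h2⟩
  have hin : ∀ ω : X × Xr × Y, law (ch.jointPmf p) (fun ω => (ω.1, ω.2.1)) (ω.1, ω.2.1)
      = p (ω.1, ω.2.1) := fun ω => by
    rw [law_input (fun u => u)]; exact law_apply_of_injective p (f := fun u => u) (fun _ _ h => h) _
  have hin' : ∀ ω : X × Xr × Y, law (ch.jointPmf p)
      (fun ω => (ω.1, ω.2.1, ch.z ω.1 ω.2.1)) (ω.1, ω.2.1, ch.z ω.1 ω.2.1)
      = p (ω.1, ω.2.1) := fun ω => by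
    rw [law_input (fun u => (u.1, u.2, ch.z u.1 u.2))]
    refine law_apply_of_injective p (f := fun u : X × Xr => (u.1, u.2, ch.z u.1 u.2)) ?_
      (ω.1, ω.2.1)
    rintro ⟨a, b⟩ ⟨a', b'⟩ h
    simp only [Prod.mk.injEq] at h ⊢
    exact ⟨h.1, h.2.1⟩
  have hall : ∀ ω : X × Xr × Y, law (ch.jointPmf p)
      (fun ω => ((ω.1, ω.2.1), ω.2.2)) ((ω.1, ω.2.1), ω.2.2) = ch.jointPmf p ω := fun ω => by
    refine law_apply_of_injective _ (f := fun ω : X × Xr × Y => ((ω.1, ω.2.1), ω.2.2)) ?_ ω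
    rintro ⟨a, b, c⟩ ⟨a', b', c'⟩ h
    simp only [Prod.mk.injEq] at h ⊢
    exact ⟨h.1.1, h.1.2, h.2⟩
  have hall' : ∀ ω : X × Xr × Y, law (ch.jointPmf p)
      (fun ω => (ω.1, ω.2.2, ω.2.1, ch.z ω.1 ω.2.1)) (ω.1, ω.2.2, ω.2.1, ch.z ω.1 ω.2.1)
      = ch.jointPmf p ω := fun ω => by
    refine law_apply_of_injective _
      (f := fun ω : X × Xr × Y => (ω.1, ω.2.2, ω.2.1, ch.z ω.1 ω.2.1)) ?_ ω
    rintro ⟨a, b, c⟩ ⟨a', b', c'⟩ h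
    simp only [Prod.mk.injEq] at h ⊢
    exact ⟨h.1, h.2.2.1, h.2.1⟩
  have hsw : ∀ ω : X × Xr × Y, law (ch.jointPmf p)
      (fun ω => (ch.z ω.1 ω.2.1, ω.2.1)) (ch.z ω.1 ω.2.1, ω.2.1) = law (ch.jointPmf p)
      (fun ω => (ω.2.1, ch.z ω.1 ω.2.1)) (ω.2.1, ch.z ω.1 ω.2.1) := fun ω =>
    law_equiv _ (fun ω : X × Xr × Y => (ω.2.1, ch.z ω.1 ω.2.1)) (Equiv.prodComm Xr Z)
      (ω.2.1, ch.z ω.1 ω.2.1)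
  simp only [rateBound]
  congr 1
  · rw [mutualInfo_eq_sum, divergence]
    refine sum_congr rfl fun ω _ => ?_
    rcases (hP ω).eq_or_lt with h | h
    · simp [← h]
    · obtain ⟨h1, h2⟩ := key ω h
      rw [hall, hin, law_output, jointPmf, mul_div_mul_left _ _ h1.ne']
  -- Because (x, x_r) determines z, the laws of (x, x_r, z) and (x, y, x_r, z) at a point are `p`
  -- and the joint pmf. The three logarithms then telescope pointwise on the support.
  · rw [condMutualInfo, condEntropy_eq_sum, condEntropy_eq_sum, condEntropy_eq_sum, divergence,
      ← sub_eq_zero]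
    simp only [sub_neg_eq_add, ← sum_neg_distrib, ← sum_add_distrib, ← sum_sub_distrib]
    refine sum_eq_zero fun ω _ => ?_
    rcases (hP ω).eq_or_lt with h | h
    · simp [← h]
    · obtain ⟨h1, h2⟩ := key ω h
      have h3 := relayLaw_pos hp h1
      have h4 := h.trans_le (le_law hP (fun ω => (ω.2.1, ch.z ω.1 ω.2.1)) ω)
      have h5 := h.trans_le (le_law hP (fun ω => (ω.2.2, ω.2.1, ch.z ω.1 ω.2.1)) ω)
      rw [hsw, hin', hall', law_relay, ← law_output_relay, Real.logb_div h4.ne' h3.ne',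
        Real.logb_div h1.ne' h4.ne', Real.logb_div h.ne' h5.ne',
        Real.logb_div h2.ne' (div_pos h5 h3).ne', Real.logb_div h5.ne' h3.ne']
      have h6 : Real.logb 2 (ch.jointPmf p ω)
          = Real.logb 2 (p (ω.1, ω.2.1)) + Real.logb 2 (ch.W ω.1 ω.2.1 ω.2.2) := by
        rw [jointPmf, Real.logb_mul h1.ne' h2.ne']
      rw [h6]
      ring

/-- The rewriting into entropies needs `0 ≤ p`, hence continuity only on the simplex, whose
compactness then yields a maximiser. -/
theorem continuousOn_rateBound : ContinuousOn ch.rateBound (stdSimplex ℝ (X × Xr)) := by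
  have hc : ∀ ω, Continuous fun p : X × Xr → ℝ => ch.jointPmf p ω := fun ω =>
    (continuous_apply _).mul continuous_const
  let vX : X × Xr × Y → X := fun ω => ω.1
  let vXr : X × Xr × Y → Xr := fun ω => ω.2.1
  let vY : X × Xr × Y → Y := fun ω => ω.2.2
  let vZ : X × Xr × Y → Z := fun ω => ch.z ω.1 ω.2.1
  refine ContinuousOn.congr (f := fun p => min
    (entropy (ch.jointPmf p) (fun ω => (vX ω, vXr ω)) + entropy (ch.jointPmf p) vY
      - entropy (ch.jointPmf p) (fun ω => ((vX ω, vXr ω), vY ω)))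
    (entropy (ch.jointPmf p) (fun ω => (vZ ω, vXr ω)) - entropy (ch.jointPmf p) vXr +
      (entropy (ch.jointPmf p) (fun ω => (vX ω, vXr ω, vZ ω))
        - entropy (ch.jointPmf p) (fun ω => (vXr ω, vZ ω))
      - (entropy (ch.jointPmf p) (fun ω => (vX ω, vY ω, vXr ω, vZ ω))
        - entropy (ch.jointPmf p) (fun ω => (vY ω, vXr ω, vZ ω)))))) ?_ ?_
  · refine Continuous.continuousOn (Continuous.min ?_ ?_)
    · exact ((continuous_entropy hc _).add (continuous_entropy hc _)).sub (continuous_entropy hc _)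
    · exact ((continuous_entropy hc _).sub (continuous_entropy hc _)).add
        (((continuous_entropy hc _).sub (continuous_entropy hc _)).sub
          ((continuous_entropy hc _).sub (continuous_entropy hc _)))
  · intro p hp
    have hP := jointPmf_nonneg (ch := ch) hp.1
    simp only [rateBound]
    rw [mutualInfo_eq_entropy hP, condMutualInfo, condEntropy_eq_entropy_sub hP,
      condEntropy_eq_entropy_sub hP, condEntropy_eq_entropy_sub hP]

theorem exists_isMaxOn_rateBound [Nonempty X] [Nonempty Xr] :
    ∃ p ∈ stdSimplex ℝ (X × Xr), ∀ p' ∈ stdSimplex ℝ (X × Xr),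
      ch.rateBound p' ≤ ch.rateBound p := by
  classical
  obtain ⟨p, hp, h⟩ := (isCompact_stdSimplex ℝ (X × Xr)).exists_isMaxOn
    ⟨_, single_mem_stdSimplex ℝ (Classical.arbitrary (X × Xr))⟩ (continuousOn_rateBound (ch := ch))
  exact ⟨p, hp, fun p' hp' => h hp'⟩

end SemidetRelayChannel

/-! ### Converse. -/

namespace SemidetRelayChannel

open FiniteInfo

variable {X Xr Y Z : Type*} [Fintype Y] {ch : SemidetRelayChannel X Xr Y Z}

theorem relayObs_eq {n M : ℕ} (c : RelayCode X Xr Y Z n M) (m : Fin M) (i : Fin n) :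
    ch.relayObs c m i = ch.z (c.enc m i) (ch.relayInput c m i) := by
  rw [relayObs, relayInput]

theorem outputProb_nonneg {n M : ℕ} (c : RelayCode X Xr Y Z n M) (m : Fin M) (y : Fin n → Y) :
    0 ≤ ch.outputProb c m y := prod_nonneg fun _ _ => ch.W_nonneg _ _ _

theorem sum_outputProb {n M : ℕ} (c : RelayCode X Xr Y Z n M) (m : Fin M) :
    ∑ y, ch.outputProb c m y = 1 :=
  sum_prod_eq_one (fun i => ch.W (c.enc m i) (ch.relayInput c m i)) fun _ => ch.W_sum _ _

open Classical in
/-- The input pmf of a code, averaged over the messages and the time slots. -/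
def inputLaw (ch : SemidetRelayChannel X Xr Y Z) {n M : ℕ} (c : RelayCode X Xr Y Z n M)
    (u : X × Xr) : ℝ :=
  (∑ m, ∑ i, if (c.enc m i, ch.relayInput c m i) = u then 1 else 0) / (n * M)

theorem inputLaw_nonneg {n M : ℕ} (c : RelayCode X Xr Y Z n M) (u : X × Xr) :
    0 ≤ ch.inputLaw c u :=
  div_nonneg (sum_nonneg fun _ _ => sum_nonneg fun _ _ => by split_ifs <;> simp) (by positivity)

/-- Supplies the absolute continuity needed for Gibbs' inequality: densities built from the input
law do not vanish where the code can put output mass. -/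
theorem inputLaw_pos {n M : ℕ} (c : RelayCode X Xr Y Z n M) (m : Fin M) (i : Fin n) :
    0 < ch.inputLaw c (c.enc m i, ch.relayInput c m i) := by
  classical
  have hn : 0 < n := i.pos
  have hM : 0 < M := m.pos
  refine div_pos ?_ (by positivity)
  refine sum_pos' (fun _ _ => sum_nonneg fun _ _ => by split_ifs <;> simp) ⟨m, mem_univ _, ?_⟩
  exact sum_pos' (fun _ _ => by split_ifs <;> simp) ⟨i, mem_univ _, by simp⟩

theorem sum_inputLaw_mul [Fintype X] [Fintype Xr] {n M : ℕ} (c : RelayCode X Xr Y Z n M)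
    (G : X × Xr → ℝ) : ∑ u, ch.inputLaw c u * G u
      = (∑ m, ∑ i, G (c.enc m i, ch.relayInput c m i)) / (n * M) := by
  classical
  simp_rw [inputLaw, div_mul_eq_mul_div]
  rw [← sum_div]
  congr 1
  simp_rw [sum_mul]
  rw [sum_comm]
  refine sum_congr rfl fun m _ => ?_
  rw [sum_comm]
  refine sum_congr rfl fun i _ => ?_
  simp

theorem inputLaw_mem_stdSimplex [Fintype X] [Fintype Xr] {n M : ℕ} (hn : 0 < n) (hM : 0 < M)
    (c : RelayCode X Xr Y Z n M) : ch.inputLaw c ∈ stdSimplex ℝ (X × Xr) := by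
  refine ⟨inputLaw_nonneg c, ?_⟩
  have := sum_inputLaw_mul (ch := ch) c fun _ => 1
  simp only [mul_one, sum_const, card_univ, Fintype.card_fin, nsmul_eq_mul] at this
  rw [this]
  have : (0 : ℝ) < n := by positivity
  have : (0 : ℝ) < M := by positivity
  field_simp

theorem sum_correct {n M : ℕ} (hM : 0 < M) (c : RelayCode X Xr Y Z n M) :
    (∑ m, ∑ y, if c.dec y = m then ch.outputProb c m y else 0) / M = 1 - ch.errorProb c := by
  have hM' : (0 : ℝ) < M := by positivity
  rw [errorProb, eq_sub_iff_add_eq, ← add_div, ← sum_add_distrib, div_eq_one_iff_eq hM'.ne']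
  have : ∀ m : Fin M, ((∑ y, if c.dec y = m then ch.outputProb c m y else 0)
      + ∑ y, if c.dec y ≠ m then ch.outputProb c m y else 0) = 1 := by
    intro m
    rw [← sum_outputProb (ch := ch) c m, ← sum_add_distrib]
    exact sum_congr rfl fun y _ => by by_cases h : c.dec y = m <;> simp [h]
  rw [sum_congr rfl fun m _ => this m]
  simp

/-- The success probability of a code is limited by the divergence from any reference density for
which the decoder cannot do better than guessing. -/
theorem log_card_le_divergence [Fintype X] [Fintype Xr] {n M : ℕ} (hn : 0 < n) (hM : 0 < M)
    (c : RelayCode X Xr Y Z n M)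
    (D : X → Xr → Y → ℝ) (hD0 : ∀ x xr y, 0 ≤ D x xr y) (hD1 : ∀ x xr, ∑ y, D x xr y ≤ 1)
    (hDpos : ∀ x xr y, 0 < ch.inputLaw c (x, xr) → 0 < ch.W x xr y → 0 < D x xr y)
    (hdec : ∑ y : Fin n → Y, ∏ i, D (c.enc (c.dec y) i) (ch.relayInput c (c.dec y) i) (y i) ≤ 1) :
    (1 - ch.errorProb c) * Real.logb 2 M - 1 ≤ n * ch.divergence (ch.inputLaw c) D := by
  classical
  have hM' : (0 : ℝ) < M := by positivity
  have hn' : (0 : ℝ) < n := by positivity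
  have hl2 : 0 < Real.log 2 := Real.log_pos (by norm_num)
  set a : Fin M → Fin n → X × Xr := fun m i => (c.enc m i, ch.relayInput c m i) with ha
  set Q : Fin M → (Fin n → Y) → ℝ := fun m y => ∏ i, D (a m i).1 (a m i).2 (y i) with hQ
  set L : X × Xr → Y → ℝ := fun u y => Real.log (ch.W u.1 u.2 y / D u.1 u.2 y) with hL
  have hQ0 : ∀ m y, 0 ≤ Q m y := fun m y => prod_nonneg fun i _ => hD0 _ _ _
  have hQ1 : ∀ m, ∑ y, Q m y ≤ 1 := fun m => by
    rw [hQ, ← Fintype.prod_sum (fun i y => D (a m i).1 (a m i).2 y)]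
    exact prod_le_one (fun i _ => sum_nonneg fun _ _ => hD0 _ _ _) fun i _ => hD1 _ _
  -- The reference measure is dominated by the half-half mixture of `Q m y / M` and of `Q m y`
  -- restricted to correct decoding, so `hQ1` and `hdec` make it a subprobability. Its factor 1/2 is
  -- the one bit lost in the conclusion.
  have hGibbs := sum_mul_log_div_nonpos (Ω := Fin M × (Fin n → Y))
    (fun ω => ch.outputProb c ω.1 ω.2 / M)
    (fun ω => Q ω.1 ω.2 / M * (if c.dec ω.2 = ω.1 then (M : ℝ) else 1) / 2)
    (fun ω => div_nonneg (outputProb_nonneg c _ _) hM'.le)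
    (fun ω => by
      have := hQ0 ω.1 ω.2
      split_ifs <;> positivity)
    (by
      rw [Fintype.sum_prod_type]
      simp_rw [← sum_div, sum_outputProb]
      simp [hM'.ne'])
    (by
      have h1 : ∀ ω : Fin M × (Fin n → Y),
          Q ω.1 ω.2 / M * (if c.dec ω.2 = ω.1 then (M : ℝ) else 1) / 2
          ≤ (Q ω.1 ω.2 / M) / 2 + (if c.dec ω.2 = ω.1 then Q ω.1 ω.2 else 0) / 2 := by
        intro ω
        have := div_nonneg (hQ0 ω.1 ω.2) hM'.le
        split_ifs
        · rw [div_mul_cancel₀ _ hM'.ne']; linarith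
        · simp
      refine (sum_le_sum fun ω _ => h1 ω).trans ?_
      rw [sum_add_distrib, Fintype.sum_prod_type, Fintype.sum_prod_type]
      have h2 : ∑ m, ∑ y, Q m y / M ≤ 1 := by
        calc ∑ m, ∑ y, Q m y / M ≤ ∑ _m : Fin M, (1 : ℝ) / M :=
              sum_le_sum fun m _ => by rw [← sum_div]; gcongr; exact hQ1 m
          _ = 1 := by simp [hM'.ne']
      have h3 : ∑ m, ∑ y, (if c.dec y = m then Q m y else 0) ≤ 1 := by
        rw [sum_comm]
        simpa using hdec
      simp only [← sum_div] at h2 ⊢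
      linarith)
    (fun ω h => by
      have hω : 0 < ch.outputProb c ω.1 ω.2 := by
        by_contra hcon
        have := le_antisymm (not_lt.1 hcon) (outputProb_nonneg c ω.1 ω.2)
        simp [this] at h
      have hWi : ∀ i, 0 < ch.W (c.enc ω.1 i) (ch.relayInput c ω.1 i) (ω.2 i) := fun i =>
        (ch.W_nonneg _ _ _).lt_of_ne' (prod_ne_zero_iff.1 hω.ne' i (mem_univ _))
      have : 0 < Q ω.1 ω.2 := prod_pos fun i _ => hDpos _ _ _ (inputLaw_pos c ω.1 i) (hWi i)
      split_ifs <;> positivity)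
  have hterm : ∀ ω : Fin M × (Fin n → Y), ch.outputProb c ω.1 ω.2 / M *
      Real.log (Q ω.1 ω.2 / M * (if c.dec ω.2 = ω.1 then (M : ℝ) else 1) / 2 /
        (ch.outputProb c ω.1 ω.2 / M))
      = (if c.dec ω.2 = ω.1 then ch.outputProb c ω.1 ω.2 else 0) / M * Real.log M
        - ch.outputProb c ω.1 ω.2 / M * Real.log 2
        - (∑ i, ch.outputProb c ω.1 ω.2 * L (a ω.1 i) (ω.2 i)) / M := by
    intro ω
    rcases (outputProb_nonneg (ch := ch) c ω.1 ω.2).eq_or_lt with h | h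
    · simp [← h]
    have hWi : ∀ i, 0 < ch.W (a ω.1 i).1 (a ω.1 i).2 (ω.2 i) := fun i =>
      (ch.W_nonneg _ _ _).lt_of_ne' (prod_ne_zero_iff.1 h.ne' i (mem_univ _))
    have hDi : ∀ i, 0 < D (a ω.1 i).1 (a ω.1 i).2 (ω.2 i) := fun i =>
      hDpos _ _ _ (inputLaw_pos c ω.1 i) (hWi i)
    have hQp : 0 < Q ω.1 ω.2 := prod_pos fun i _ => hDi i
    have hlog : Real.log (Q ω.1 ω.2 / ch.outputProb c ω.1 ω.2) = -∑ i, L (a ω.1 i) (ω.2 i) := by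
      rw [Real.log_div hQp.ne' h.ne', hQ, outputProb, Real.log_prod (fun i _ => (hDi i).ne'),
        Real.log_prod (fun i _ => (hWi i).ne'), ← sum_sub_distrib, ← sum_neg_distrib]
      refine sum_congr rfl fun i _ => ?_
      rw [hL]
      simp only
      rw [Real.log_div (hWi i).ne' (hDi i).ne']
      ring
    rw [← mul_sum, ← neg_eq_iff_eq_neg.2 hlog]
    by_cases hd : c.dec ω.2 = ω.1
    · have : Q ω.1 ω.2 / M * M / 2 / (ch.outputProb c ω.1 ω.2 / M)
          = Q ω.1 ω.2 / ch.outputProb c ω.1 ω.2 * M / 2 := by field_simp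
      rw [if_pos hd, if_pos hd, this, Real.log_div (by positivity) (by norm_num),
        Real.log_mul (by positivity) hM'.ne']
      ring
    · have : Q ω.1 ω.2 / M * 1 / 2 / (ch.outputProb c ω.1 ω.2 / M)
          = Q ω.1 ω.2 / ch.outputProb c ω.1 ω.2 / 2 := by field_simp
      rw [if_neg hd, if_neg hd, this, Real.log_div (by positivity) (by norm_num)]
      ring
  simp_rw [hterm] at hGibbs
  rw [sum_sub_distrib, sum_sub_distrib, ← sum_mul, ← sum_mul, ← sum_div, ← sum_div, ← sum_div,
    Fintype.sum_prod_type, Fintype.sum_prod_type, Fintype.sum_prod_type] at hGibbs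
  rw [sum_correct hM] at hGibbs
  simp_rw [sum_outputProb] at hGibbs
  have hinner : ∀ m, ∑ y : Fin n → Y, ∑ i, ch.outputProb c m y * L (a m i) (y i)
      = ∑ i, ∑ y, ch.W (a m i).1 (a m i).2 y * L (a m i) y := by
    intro m
    rw [sum_comm]
    exact sum_congr rfl fun i _ => sum_prod_mul_apply
      (fun i => ch.W (c.enc m i) (ch.relayInput c m i)) (fun _ => ch.W_sum _ _) i _
  have hdiv : n * ch.divergence (ch.inputLaw c) D * Real.log 2
      = (∑ m, ∑ y : Fin n → Y, ∑ i, ch.outputProb c m y * L (a m i) (y i)) / M := by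
    simp_rw [hinner]
    have hlogb : ∀ u : X × Xr, ∑ y, ch.W u.1 u.2 y * Real.logb 2 (ch.W u.1 u.2 y / D u.1 u.2 y)
        = (∑ y, ch.W u.1 u.2 y * L u y) / Real.log 2 := fun u => by
      rw [sum_div]; exact sum_congr rfl fun y _ => by rw [Real.logb]; ring
    rw [divergence, sum_jointPmf_mul, sum_congr rfl fun u _ => congrArg _ (hlogb u),
      sum_inputLaw_mul]
    simp only [← sum_div]
    field_simp
    rfl
  rw [← hdiv] at hGibbs
  rw [← mul_le_mul_iff_left₀ hl2, sub_mul, mul_assoc, Real.logb, div_mul_cancel₀ _ hl2.ne']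
  have h1 : (∑ _m : Fin M, (1 : ℝ)) / M = 1 := by simp [hM'.ne']
  rw [h1] at hGibbs
  linarith

theorem sum_outLaw [Fintype X] [Fintype Xr] {p : X × Xr → ℝ} (hp : p ∈ stdSimplex ℝ (X × Xr)) :
    ∑ y, ch.outLaw p y = 1 := by
  simp_rw [outLaw]
  rw [sum_comm]
  simp_rw [← mul_sum, ch.W_sum, mul_one]
  exact hp.2

theorem outLaw_nonneg [Fintype X] [Fintype Xr] {p : X × Xr → ℝ} (hp : ∀ u, 0 ≤ p u) (y : Y) :
    0 ≤ ch.outLaw p y := sum_nonneg fun u _ => mul_nonneg (hp u) (ch.W_nonneg _ _ _)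

theorem relayLaw_nonneg [Fintype X] {p : X × Xr → ℝ} (hp : ∀ u, 0 ≤ p u) (xr : Xr) :
    0 ≤ relayLaw p xr := sum_nonneg fun _ _ => hp _

theorem condLaw_nonneg [Fintype X] {p : X × Xr → ℝ} (hp : ∀ u, 0 ≤ p u) (xr : Xr) (z : Z)
    (y : Y) : 0 ≤ ch.condLaw p xr z y := by
  refine div_nonneg (sum_nonneg fun x _ => ?_) (relayLaw_nonneg hp xr)
  split_ifs
  · exact mul_nonneg (hp _) (ch.W_nonneg _ _ _)
  · exact le_rfl

theorem sum_condLaw_le_one [Fintype X] [Fintype Z] {p : X × Xr → ℝ} (hp : ∀ u, 0 ≤ p u)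
    (xr : Xr) : ∑ z, ∑ y, ch.condLaw p xr z y ≤ 1 := by
  classical
  simp_rw [condLaw, ← sum_div]
  refine div_le_one_of_le₀ (le_of_eq ?_) (relayLaw_nonneg hp xr)
  rw [sum_congr rfl fun z _ => sum_comm, sum_comm]
  refine sum_congr rfl fun x _ => ?_
  rw [sum_comm]
  calc _ = ∑ y, p (x, xr) * ch.W x xr y := sum_congr rfl fun y _ => by simp
    _ = p (x, xr) := by rw [← mul_sum, ch.W_sum, mul_one]

variable [Fintype X] [Fintype Xr] [Fintype Z]

/-- The same averaged input law serves both divergences and all time slots, so no concavity in the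
input pmf is needed. -/
theorem log_card_le_rateBound {n M : ℕ} (hn : 0 < n) (hM : 0 < M) (c : RelayCode X Xr Y Z n M) :
    (1 - ch.errorProb c) * Real.logb 2 M - 1 ≤ n * ch.rateBound (ch.inputLaw c) := by
  have hp := inputLaw_mem_stdSimplex (ch := ch) hn hM c
  set p := ch.inputLaw c with hpdef
  rw [rateBound_eq_min_divergence hp.1, mul_min_of_nonneg _ _ (by positivity), le_min_iff]
  constructor
  · refine log_card_le_divergence hn hM c _ (fun _ _ y => outLaw_nonneg hp.1 y)
      (fun _ _ => (sum_outLaw hp).le) (fun x xr y h hW => outLaw_pos hp.1 h hW) ?_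
    exact (sum_prod_eq_one (fun _ => ch.outLaw p) fun _ => sum_outLaw hp).le
  · refine log_card_le_divergence hn hM c _ (fun x xr y => condLaw_nonneg hp.1 _ _ _)
      (fun x xr => ?_) (fun x xr y h hW => condLaw_pos hp.1 h hW) ?_
    · exact (single_le_sum (f := fun z => ∑ y, ch.condLaw p xr z y) (fun z _ =>
        sum_nonneg fun y _ => condLaw_nonneg hp.1 _ _ _) (mem_univ (ch.z x xr))).trans
          (sum_condLaw_le_one hp.1 xr)
    -- The product sees the decoded message only through its observation sequence, so it is one term
    -- of the sum over all sequences `z`. Summing over `y` first leaves causal kernels in `z`.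
    · calc _ ≤ ∑ y : Fin n → Y, ∑ z : Fin n → Z, ∏ i, ch.condLaw p
            (c.relay i fun j => z ⟨j.val, j.isLt.trans i.isLt⟩) (z i) (y i) := by
            refine sum_le_sum fun y _ => ?_
            have := single_le_sum (f := fun z : Fin n → Z => ∏ i, ch.condLaw p
              (c.relay i fun j => z ⟨j.val, j.isLt.trans i.isLt⟩) (z i) (y i))
              (fun z _ => prod_nonneg fun i _ => condLaw_nonneg hp.1 _ _ _)
              (mem_univ (ch.relayObs c (c.dec y)))
            refine le_trans (le_of_eq (prod_congr rfl fun i _ => ?_)) this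
            rw [relayObs_eq, relayInput]
        _ = ∑ z : Fin n → Z, ∏ i, ∑ y, ch.condLaw p
            (c.relay i fun j => z ⟨j.val, j.isLt.trans i.isLt⟩) (z i) y := by
            rw [sum_comm]
            exact sum_congr rfl fun z _ => by rw [Fintype.prod_sum]
        _ ≤ 1 := sum_causal_prod_le_one
            (fun i past z => ∑ y, ch.condLaw p (c.relay i past) z y)
            (fun i past z => sum_nonneg fun y _ => condLaw_nonneg hp.1 _ _ _)
            (fun i past => sum_condLaw_le_one hp.1 _)

theorem le_of_achievable {R C : ℝ} (hR : ch.Achievable R)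
    (hC : ∀ p ∈ stdSimplex ℝ (X × Xr), ch.rateBound p ≤ C) : R ≤ C := by
  obtain ⟨hR0, hR⟩ := hR
  by_contra! hlt
  -- This error level costs at most `n * (R - C) / 2` bits. Rounding the message set and the bit
  -- lost in `log_card_le_rateBound` cost two more, which `n > 4 / (R - C)` outweighs.
  set ε := (R - C) / (2 * (R + 1)) with hε
  have hε0 : 0 < ε := div_pos (by linarith) (by linarith)
  have hεR : ε * R ≤ (R - C) / 2 := by
    have : ε * (R + 1) = (R - C) / 2 := by
      rw [hε]; field_simp
    nlinarith
  obtain ⟨N, hN⟩ := hR ε hε0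
  obtain ⟨k, hk⟩ := exists_nat_gt (4 / (R - C))
  set n := max N (k + 1) with hn
  have hn0 : 0 < n := by omega
  have hn1 : 4 / (R - C) < n := hk.trans_le (by
    rw [hn]; push_cast; exact le_trans (by linarith) (le_max_right _ _))
  have hn' : (0 : ℝ) < n := by positivity
  have h1 : (1 : ℝ) ≤ 2 ^ ((n : ℝ) * R) := Real.one_le_rpow (by norm_num) (by positivity)
  set M := ⌊(2 : ℝ) ^ ((n : ℝ) * R)⌋₊ with hM
  obtain ⟨c, hc⟩ : ∃ c : RelayCode X Xr Y Z n M, ch.errorProb c ≤ ε := hN n (le_max_left _ _)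
  have hM0 : 0 < M := Nat.floor_pos.2 h1
  have hM1 : (1 : ℝ) ≤ M := by exact_mod_cast hM0
  have hMle : (M : ℝ) ≤ 2 ^ ((n : ℝ) * R) := Nat.floor_le (by positivity)
  have hMge : (2 : ℝ) ^ ((n : ℝ) * R - 1) ≤ M := by
    have := Nat.lt_floor_add_one ((2 : ℝ) ^ ((n : ℝ) * R))
    rw [Real.rpow_sub (by norm_num), Real.rpow_one]
    linarith
  have hlog1 : (n : ℝ) * R - 1 ≤ Real.logb 2 M := by
    rw [Real.le_logb_iff_rpow_le (by norm_num) (by linarith)]; exact hMge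
  have hlog2 : Real.logb 2 M ≤ n * R := by
    rw [Real.logb_le_iff_le_rpow (by norm_num) (by linarith)]; exact hMle
  have hlog0 : 0 ≤ Real.logb 2 M := Real.logb_nonneg (by norm_num) hM1
  have hmain := log_card_le_rateBound (ch := ch) hn0 hM0 c
  have hCn := mul_le_mul_of_nonneg_left
    (hC _ (inputLaw_mem_stdSimplex (ch := ch) hn0 hM0 c)) hn'.le
  have h2 : ch.errorProb c * Real.logb 2 M ≤ ε * (n * R) :=
    mul_le_mul hc hlog2 hlog0 hε0.le
  have h3 : n * (ε * R) ≤ n * ((R - C) / 2) := mul_le_mul_of_nonneg_left hεR hn'.le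
  have h4 : 4 < n * (R - C) := by
    rwa [div_lt_iff₀ (by linarith)] at hn1
  nlinarith

end SemidetRelayChannel

/-! ### Random hashing and random superposition codebooks. -/

namespace FiniteInfo

section Averages

variable {Ω : Type*} [Fintype Ω]

/-- The weighted average of `g`. -/
def avg (w g : Ω → ℝ) : ℝ := ∑ ω, w ω * g ω

theorem avg_add (w g h : Ω → ℝ) : avg w (fun ω => g ω + h ω) = avg w g + avg w h := by
  simp [avg, mul_add, sum_add_distrib]

theorem avg_sum {ι : Type*} (s : Finset ι) (w : Ω → ℝ) (g : ι → Ω → ℝ) :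
    avg w (fun ω => ∑ i ∈ s, g i ω) = ∑ i ∈ s, avg w (g i) := by
  simp_rw [avg, mul_sum]
  exact sum_comm

theorem avg_mul_left (w g : Ω → ℝ) (c : ℝ) : avg w (fun ω => c * g ω) = c * avg w g := by
  rw [avg, avg, mul_sum]
  exact sum_congr rfl fun ω _ => by ring

theorem avg_const {w : Ω → ℝ} (hs : ∑ ω, w ω = 1) (c : ℝ) : avg w (fun _ => c) = c := by
  rw [avg, ← sum_mul, hs, one_mul]

theorem avg_mono {w g h : Ω → ℝ} (hw : ∀ ω, 0 ≤ w ω) (hgh : ∀ ω, g ω ≤ h ω) :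
    avg w g ≤ avg w h :=
  sum_le_sum fun ω _ => mul_le_mul_of_nonneg_left (hgh ω) (hw ω)

end Averages

section Hash

variable {I T : Type*} [Fintype I] [DecidableEq I] [Fintype T] [Nonempty T]

theorem sum_card_inv : ∑ _t : T, (1 : ℝ) / Fintype.card T = 1 := by
  simp

/-- Uniformly random hash values of distinct points collide with probability `1 / |T|`. -/
theorem avg_hash_collision [DecidableEq T] (i j : I) :
    avg (fun _ : I → T => ∏ _i : I, (1 : ℝ) / Fintype.card T) (fun F => if F i = F j then 1 else 0)
      = if i = j then 1 else (1 : ℝ) / Fintype.card T := by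
  have hs := sum_card_inv (T := T)
  by_cases h : i = j
  · subst h
    simp only [if_true]
    exact avg_const (sum_prod_eq_one (fun _ : I => fun _ : T => (1 : ℝ) / Fintype.card T)
      fun _ => hs) 1
  · rw [avg, sum_prod_mul_apply_two (fun _ : I => fun _ : T => (1 : ℝ) / Fintype.card T)
      (fun _ => hs) h (fun a b => if a = b then 1 else 0), if_neg h]
    simp

end Hash

section RandomHash

variable {C D M S T : Type*} [Fintype C] [Fintype D] [Fintype M] [Fintype S] [Fintype T]
  [DecidableEq D] [DecidableEq M] [DecidableEq S] [DecidableEq T]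
  [Nonempty M] [Nonempty S] [Nonempty T]

open Classical in
/-- For a given codebook, in which the pair `j` produces the relay observation `z j` and the output
law `w j`, some hash function allows to recover `j` from the output and the hash value with an
error bounded by the union bound averaged over all hash functions. -/
theorem exists_hash_decoder (z : M × S → D) (w : M × S → C → ℝ) (hw : ∀ j c, 0 ≤ w j c)
    (Typ : M × S → C → Prop) {K : ℕ} (φ : Fin K → M × S) :
    ∃ (F : S → D → T) (dec : C → T → M × S),
      ∑ k, ∑ c, (if dec c (F (φ k).2 (z (φ k))) ≠ φ k then w (φ k) c else 0) ≤
        ∑ k, ∑ c, w (φ k) c * ((if Typ (φ k) c then 0 else 1) + ∑ j, if j ≠ φ k ∧ Typ j c then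
          (if (j.2, z j) = ((φ k).2, z (φ k)) then 1 else (1 : ℝ) / Fintype.card T) else 0) := by
  set wt : (S × D → T) → ℝ := fun _ => ∏ _i : S × D, (1 : ℝ) / Fintype.card T with hwt
  have hwt0 : ∀ F, 0 ≤ wt F := fun F => prod_nonneg fun _ _ => by positivity
  have hwt1 : ∑ F, wt F = 1 := sum_prod_eq_one (fun _ : S × D => fun _ : T =>
    (1 : ℝ) / Fintype.card T) fun _ => sum_card_inv
  set g : (S × D → T) → ℝ := fun F => ∑ k, ∑ c, w (φ k) c * ((if Typ (φ k) c then 0 else 1) +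
    ∑ j, (if j ≠ φ k ∧ Typ j c then 1 else 0) *
      (if F (j.2, z j) = F ((φ k).2, z (φ k)) then 1 else 0)) with hg
  obtain ⟨F, hF⟩ := exists_le_of_weighted_sum_le wt hwt0 hwt1 g (le_refl (avg wt g))
  -- The decoder takes any typical pair with the right hash. It errs only if the true pair is
  -- atypical, which covers the default value, or if another pair is a candidate, which is a term of
  -- the union bound.
  refine ⟨fun s d => F (s, d), fun c h => if hex : ∃ j, Typ j c ∧ F (j.2, z j) = h then
    hex.choose else Classical.arbitrary _, le_trans ?_ (hF.trans (le_of_eq ?_))⟩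
  · refine sum_le_sum fun k _ => sum_le_sum fun c _ => ?_
    have hnn : ∀ j, 0 ≤ (if j ≠ φ k ∧ Typ j c then (1 : ℝ) else 0) *
      (if F (j.2, z j) = F ((φ k).2, z (φ k)) then 1 else 0) := fun j => by positivity
    have hsum0 := sum_nonneg fun j (_ : j ∈ univ) => hnn j
    split_ifs with hne hT hT
    · refine le_mul_of_one_le_right (hw _ _) ?_
      have hex : ∃ j, Typ j c ∧ F (j.2, z j) = F ((φ k).2, z (φ k)) := ⟨φ k, hT, rfl⟩
      simp only [dif_pos hex] at hne
      refine le_trans (le_trans (le_of_eq ?_) (single_le_sum (fun j _ => hnn j)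
        (mem_univ hex.choose))) (le_add_of_nonneg_left le_rfl)
      rw [if_pos ⟨hne, hex.choose_spec.1⟩, if_pos hex.choose_spec.2, one_mul]
    · exact le_mul_of_one_le_right (hw _ _) (le_add_of_nonneg_right hsum0)
    · exact mul_nonneg (hw _ _) (by simpa using hsum0)
    · exact mul_nonneg (hw _ _) (by linarith)
  · rw [hg, avg_sum]
    refine sum_congr rfl fun k _ => ?_
    rw [avg_sum]
    refine sum_congr rfl fun c _ => ?_
    rw [avg_mul_left, avg_add, avg_const hwt1, avg_sum]
    congr 2
    refine sum_congr rfl fun j _ => ?_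
    rw [avg_mul_left, hwt, avg_hash_collision]
    by_cases h : j ≠ φ k ∧ Typ j c
    · rw [if_pos h, if_pos h, one_mul]
    · rw [if_neg h, if_neg h, zero_mul]

end RandomHash

section Codebook

variable {A B M S : Type*} [Fintype A] [Fintype B] [Fintype M] [Fintype S]
  [DecidableEq M] [DecidableEq S]

/-- The probability of a random codebook: relay codewords drawn from `r` and, given the relay
codeword, source codewords drawn from `k`. -/
def codebookWeight (M S : Type*) [Fintype M] [Fintype S] (r : B → ℝ) (k : B → A → ℝ)
    (ω : S → B × (M → A)) : ℝ :=
  ∏ s, (r (ω s).1 * ∏ m, k (ω s).1 ((ω s).2 m))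

variable {r : B → ℝ} {k : B → A → ℝ} (hr : ∑ b, r b = 1) (hk : ∀ b, ∑ a, k b a = 1)
include hr hk

theorem sum_cluster : ∑ u : B × (M → A), r u.1 * ∏ m, k u.1 (u.2 m) = 1 := by
  rw [Fintype.sum_prod_type]
  simp only
  simp_rw [← mul_sum]
  rw [← hr]
  exact sum_congr rfl fun b _ => by rw [sum_prod_eq_one (fun _ => k b) fun _ => hk b, mul_one]

theorem sum_codebookWeight : ∑ ω, codebookWeight M S r k ω = 1 :=
  sum_prod_eq_one (fun _ : S => fun u : B × (M → A) => r u.1 * ∏ m, k u.1 (u.2 m))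
    fun _ => sum_cluster hr hk

theorem avg_codebook_single (s : S) (m : M) (g : B → A → ℝ) :
    avg (codebookWeight M S r k) (fun ω => g (ω s).1 ((ω s).2 m))
      = ∑ b, ∑ a, r b * k b a * g b a := by
  have := sum_prod_mul_apply (fun _ : S => fun u : B × (M → A) => r u.1 * ∏ m, k u.1 (u.2 m))
    (fun _ => sum_cluster hr hk) s (fun u => g u.1 (u.2 m))
  rw [avg]
  refine this.trans ?_
  rw [Fintype.sum_prod_type]
  refine sum_congr rfl fun b _ => ?_
  have := sum_prod_mul_apply (fun _ : M => k b) (fun _ => hk b) m (g b)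
  simp_rw [mul_assoc, ← mul_sum]
  rw [this]

/-- Two source codewords of one cluster are independent only given their common relay codeword,
which is therefore averaged outside. -/
theorem avg_codebook_same_cluster (s : S) {m m' : M} (h : m ≠ m') (g : B → A → A → ℝ) :
    avg (codebookWeight M S r k) (fun ω => g (ω s).1 ((ω s).2 m) ((ω s).2 m'))
      = ∑ b, r b * ∑ a, ∑ a', k b a * k b a' * g b a a' := by
  have := sum_prod_mul_apply (fun _ : S => fun u : B × (M → A) => r u.1 * ∏ m, k u.1 (u.2 m))
    (fun _ => sum_cluster hr hk) s (fun u => g u.1 (u.2 m) (u.2 m'))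
  rw [avg]
  refine this.trans ?_
  rw [Fintype.sum_prod_type]
  refine sum_congr rfl fun b _ => ?_
  have := sum_prod_mul_apply_two (fun _ : M => k b) (fun _ => hk b) h (g b)
  simp_rw [mul_assoc (r b), ← mul_sum]
  rw [this]

theorem avg_codebook_distinct_clusters {s s' : S} (h : s ≠ s') (m m' : M)
    (g : B → A → B → A → ℝ) :
    avg (codebookWeight M S r k) (fun ω => g (ω s).1 ((ω s).2 m) (ω s').1 ((ω s').2 m'))
      = ∑ b, ∑ a, r b * k b a * ∑ b', ∑ a', r b' * k b' a' * g b a b' a' := by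
  have := sum_prod_mul_apply_two
    (fun _ : S => fun u : B × (M → A) => r u.1 * ∏ m, k u.1 (u.2 m))
    (fun _ => sum_cluster hr hk) h (fun u u' => g u.1 (u.2 m) u'.1 (u'.2 m'))
  rw [avg]
  refine this.trans ?_
  have hinner : ∀ u : B × (M → A), ∑ u' : B × (M → A), (r u.1 * ∏ m, k u.1 (u.2 m)) *
      (r u'.1 * ∏ m, k u'.1 (u'.2 m)) * g u.1 (u.2 m) u'.1 (u'.2 m')
      = (r u.1 * ∏ m, k u.1 (u.2 m)) *
        ∑ b', ∑ a', r b' * k b' a' * g u.1 (u.2 m) b' a' := by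
    intro u
    simp_rw [mul_assoc (r u.1 * _), ← mul_sum]
    congr 1
    rw [Fintype.sum_prod_type]
    refine sum_congr rfl fun b _ => ?_
    have := sum_prod_mul_apply (fun _ : M => k b) (fun _ => hk b) m' (g u.1 (u.2 m) b)
    simp_rw [mul_assoc, ← mul_sum]
    rw [this]
  simp_rw [hinner]
  rw [Fintype.sum_prod_type]
  refine sum_congr rfl fun b _ => ?_
  have := sum_prod_mul_apply (fun _ : M => k b) (fun _ => hk b) m
    (fun a => ∑ b', ∑ a', r b' * k b' a' * g b a b' a')
  simp_rw [mul_assoc (r b), ← mul_sum]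
  rw [this]

end Codebook

/-! ### Pairwise error probabilities. -/

section PairBounds

variable {A B C D : Type*} [Fintype A] [Fintype B] [Fintype C] [DecidableEq D]

open Classical in
/-- An independent pair of codewords looks typical with the output with probability at most
`1 / t`. -/
theorem sum_codeword_pair_le (r : B → ℝ) (k : B → A → ℝ) (W : A → B → C → ℝ)
    (q : C → ℝ) {t : ℝ} (ht : 0 < t)
    (hr0 : ∀ b, 0 ≤ r b) (hr : ∑ b, r b = 1) (hk0 : ∀ b a, 0 ≤ k b a) (hk : ∀ b, ∑ a, k b a = 1)
    (hW : ∀ a b, ∑ c, W a b c = 1) (hW0 : ∀ a b c, 0 ≤ W a b c)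
    (hq : ∀ c, ∑ b, ∑ a, r b * k b a * W a b c = q c)
    (Typ : A → B → C → Prop) (hTyp : ∀ a b c, Typ a b c → t * q c < W a b c) :
    ∑ b', ∑ a', r b' * k b' a' * ∑ b, ∑ a, r b * k b a *
      ∑ c, W a b c * (if Typ a' b' c then 1 else 0) ≤ 1 / t := by
  have h1 : ∀ b' a', ∑ b, ∑ a, r b * k b a * ∑ c, W a b c * (if Typ a' b' c then 1 else 0)
      ≤ 1 / t := by
    intro b' a'
    -- Averaging over the transmitted pair turns its output law into `q`. On outputs typical for
    -- `a'`, `b'`, `q` is below `W a' b' / t`, which has total mass `1 / t`.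
    have : ∑ b, ∑ a, r b * k b a * ∑ c, W a b c * (if Typ a' b' c then 1 else 0)
        = ∑ c, q c * (if Typ a' b' c then 1 else 0) := by
      simp_rw [← hq, mul_sum, sum_mul]
      rw [sum_congr rfl fun b _ => sum_comm, sum_comm]
      exact sum_congr rfl fun c _ => sum_congr rfl fun b _ => sum_congr rfl fun a _ => by ring
    rw [this, show 1 / t = ∑ c, W a' b' c / t by rw [← sum_div, hW a' b']]
    refine sum_le_sum fun c _ => ?_
    rw [le_div_iff₀ ht]
    split_ifs with h
    · have := hTyp _ _ _ h
      linarith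
    · simpa using hW0 a' b' c
  calc _ ≤ ∑ b', ∑ a', r b' * k b' a' * (1 / t) := sum_le_sum fun b' _ => sum_le_sum fun a' _ =>
        mul_le_mul_of_nonneg_left (h1 _ _) (mul_nonneg (hr0 _) (hk0 _ _))
    _ = 1 / t := by
        simp_rw [← sum_mul, ← mul_sum, hk, mul_one, hr, one_mul]

open Classical in
/-- A second source codeword on the same relay codeword produces the same relay observation and
looks typical with the output with probability at most `1 / t`. -/
theorem sum_source_pair_le (r : B → ℝ) (k : B → A → ℝ) (W : A → B → C → ℝ) (z : A → B → D)
    (v : B → D → C → ℝ) {t : ℝ} (ht : 0 < t)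
    (hr0 : ∀ b, 0 ≤ r b) (hr : ∑ b, r b = 1) (hk0 : ∀ b a, 0 ≤ k b a) (hk : ∀ b, ∑ a, k b a = 1)
    (hW : ∀ a b, ∑ c, W a b c = 1) (hW0 : ∀ a b c, 0 ≤ W a b c)
    (hv : ∀ b d c, ∑ a, k b a * (if z a b = d then W a b c else 0) = v b d c)
    (Typ : A → B → C → Prop) (hTyp : ∀ a b c, Typ a b c → t * v b (z a b) c < W a b c) :
    ∑ b, r b * ∑ a', ∑ a, k b a' * k b a *
      ∑ c, W a b c * (if Typ a' b c ∧ z a b = z a' b then 1 else 0) ≤ 1 / t := by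
  have h1 : ∀ b a', ∑ a, k b a' * k b a * ∑ c, W a b c *
      (if Typ a' b c ∧ z a b = z a' b then 1 else 0) ≤ k b a' * (1 / t) := by
    intro b a'
    simp_rw [mul_assoc (k b a'), ← mul_sum]
    refine mul_le_mul_of_nonneg_left ?_ (hk0 _ _)
    -- Averaging over the transmitted codewords that share the observation of `a'` gives `v b (z a'
    -- b)`, and typicality compares exactly this with `W a' b`.
    have : ∑ a, k b a * ∑ c, W a b c * (if Typ a' b c ∧ z a b = z a' b then 1 else 0)
        = ∑ c, v b (z a' b) c * (if Typ a' b c then 1 else 0) := by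
      simp_rw [← hv, mul_sum, sum_mul]
      rw [sum_comm]
      refine sum_congr rfl fun c _ => sum_congr rfl fun a _ => ?_
      by_cases h1 : Typ a' b c <;> by_cases h2 : z a b = z a' b <;> simp [h1, h2]
    rw [this, show 1 / t = ∑ c, W a' b c / t by rw [← sum_div, hW a' b]]
    refine sum_le_sum fun c _ => ?_
    rw [le_div_iff₀ ht]
    split_ifs with h
    · have := hTyp _ _ _ h
      linarith
    · simpa using hW0 a' b c
  calc _ ≤ ∑ b, r b * ∑ a', k b a' * (1 / t) := sum_le_sum fun b _ =>
        mul_le_mul_of_nonneg_left (sum_le_sum fun a' _ => h1 _ _) (hr0 _)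
    _ = 1 / t := by simp_rw [← sum_mul, hk, one_mul, ← sum_mul, hr, one_mul]

end PairBounds

/-! ### One-shot coding for a block with unknown relay state. -/

section OneShot

variable {A B C D M S T : Type*} [Fintype A] [Fintype B] [Fintype C] [Fintype D] [Fintype M]
  [Fintype S] [Fintype T] [DecidableEq D] [DecidableEq M] [DecidableEq S] [DecidableEq T]
  [Nonempty M] [Nonempty S] [Nonempty T]

open Classical in
/-- One-shot random coding for a block whose initial relay state `s` is unknown to the decoder
while a hash of `s` and of the relay observations is known. -/
theorem exists_block_code (r : B → ℝ) (k : B → A → ℝ) (W : A → B → C → ℝ) (z : A → B → D)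
    (q : C → ℝ) (v : B → D → C → ℝ) {t : ℝ} (ht : 0 < t)
    (hr0 : ∀ b, 0 ≤ r b) (hr : ∑ b, r b = 1) (hk0 : ∀ b a, 0 ≤ k b a) (hk : ∀ b, ∑ a, k b a = 1)
    (hW0 : ∀ a b c, 0 ≤ W a b c) (hW : ∀ a b, ∑ c, W a b c = 1)
    (hq : ∀ c, ∑ b, ∑ a, r b * k b a * W a b c = q c)
    (hv : ∀ b d c, ∑ a, k b a * (if z a b = d then W a b c else 0) = v b d c)
    {K : ℕ} (φ : Fin K → M × S) :
    ∃ (xr : S → B) (x : M → S → A) (F : S → D → T) (dec : C → T → M × S),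
      ∑ i, ∑ c, (if dec c (F (φ i).2 (z (x (φ i).1 (φ i).2) (xr (φ i).2))) ≠ φ i then
        W (x (φ i).1 (φ i).2) (xr (φ i).2) c else 0) ≤
      K * ((∑ b, ∑ a, r b * k b a * ∑ c, if W a b c ≤ t * q c then W a b c else 0)
        + (∑ b, ∑ a, r b * k b a * ∑ c, if W a b c ≤ t * v b (z a b) c then W a b c else 0)
        + Fintype.card M * Fintype.card S * (1 / (Fintype.card T * t))
        + (Fintype.card M - 1) * (1 / t + 1 / Fintype.card T)) := by
  -- The threshold against `q` rejects pairs with a wrong state; the one against `v` rejects wrong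
  -- source codewords under the right state.
  obtain ⟨Typ, hTyp⟩ : ∃ Typ : A → B → C → Prop, ∀ a b c,
      Typ a b c ↔ t * q c < W a b c ∧ t * v b (z a b) c < W a b c := ⟨_, fun _ _ _ => Iff.rfl⟩
  set wt := codebookWeight M S r k with hwt
  have hwt0 : ∀ ω, 0 ≤ wt ω := fun ω =>
    prod_nonneg fun s _ => mul_nonneg (hr0 _) (prod_nonneg fun m _ => hk0 _ _)
  have hwt1 : ∑ ω, wt ω = 1 := sum_codebookWeight hr hk
  set e1 := ∑ b, ∑ a, r b * k b a * ∑ c, if W a b c ≤ t * q c then W a b c else 0 with he1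
  set e2 := ∑ b, ∑ a, r b * k b a * ∑ c, if W a b c ≤ t * v b (z a b) c then W a b c else 0
    with he2
  have hT : (0 : ℝ) < Fintype.card T := by exact_mod_cast Fintype.card_pos
  let xs : (S → B × (M → A)) → M × S → A := fun ω j => (ω j.2).2 j.1
  let xrs : (S → B × (M → A)) → M × S → B := fun ω j => (ω j.2).1
  let κ : (S → B × (M → A)) → M × S → M × S → ℝ := fun ω i j =>
    if (j.2, z (xs ω j) (xrs ω j)) = (i.2, z (xs ω i) (xrs ω i)) then 1
      else (1 : ℝ) / Fintype.card T
  let miss : (S → B × (M → A)) → M × S → ℝ := fun ω i =>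
    ∑ c, W (xs ω i) (xrs ω i) c * (if Typ (xs ω i) (xrs ω i) c then 0 else 1)
  let pr : (S → B × (M → A)) → M × S → M × S → ℝ := fun ω i j =>
    ∑ c, W (xs ω i) (xrs ω i) c * (if Typ (xs ω j) (xrs ω j) c then κ ω i j else 0)
  have hmiss : ∀ i, avg wt (fun ω => miss ω i) ≤ e1 + e2 := by
    intro i
    refine (avg_codebook_single hr hk i.2 i.1 (fun b a =>
      ∑ c, W a b c * (if Typ a b c then 0 else 1))).le.trans ?_
    rw [he1, he2, ← sum_add_distrib]
    refine sum_le_sum fun b _ => ?_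
    rw [← sum_add_distrib]
    refine sum_le_sum fun a _ => ?_
    rw [← mul_add, ← sum_add_distrib]
    refine mul_le_mul_of_nonneg_left (sum_le_sum fun c _ => ?_) (mul_nonneg (hr0 _) (hk0 _ _))
    have h0 := hW0 a b c
    by_cases hty : Typ a b c
    · rw [if_pos hty]
      split_ifs <;> linarith
    · rw [if_neg hty]
      rcases not_and_or.1 (mt (hTyp a b c).2 hty) with h | h
      · rw [if_pos (not_lt.1 h)]
        split_ifs <;> linarith
      · rw [if_pos (not_lt.1 h)]
        split_ifs <;> linarith
  have hdiff : ∀ i j : M × S, i.2 ≠ j.2 →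
      avg wt (fun ω => pr ω i j) ≤ 1 / (Fintype.card T * t) := by
    intro i j hij
    have h1 : ∀ ω, pr ω i j = 1 / Fintype.card T * ∑ c, W (xs ω i) (xrs ω i) c *
        (if Typ (xs ω j) (xrs ω j) c then 1 else 0) := by
      intro ω
      rw [mul_sum]
      refine sum_congr rfl fun c _ => ?_
      have : κ ω i j = 1 / Fintype.card T := if_neg fun e => hij (Prod.ext_iff.1 e).1.symm
      rw [this]
      split_ifs <;> ring
    simp_rw [h1]
    rw [avg_mul_left, ← one_div_mul_one_div]
    refine mul_le_mul_of_nonneg_left ?_ (by positivity)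
    refine (avg_codebook_distinct_clusters hr hk hij.symm j.1 i.1 (fun b' a' b a =>
      ∑ c, W a b c * (if Typ a' b' c then 1 else 0))).le.trans ?_
    exact sum_codeword_pair_le r k W q ht hr0 hr hk0 hk hW hW0 hq Typ fun a b c h =>
      ((hTyp a b c).1 h).1
  -- Either the observations agree and typicality against `v` gives `1 / t`, or the hashes collide
  -- by chance; the chance term is bounded without using typicality.
  have hsame : ∀ i j : M × S, i.2 = j.2 → i.1 ≠ j.1 →
      avg wt (fun ω => pr ω i j) ≤ 1 / t + 1 / Fintype.card T := by
    intro i j hij hne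
    have h1 : ∀ ω, pr ω i j ≤ (∑ c, W (xs ω i) (xrs ω i) c * (if Typ (xs ω j) (xrs ω j) c ∧
        z (xs ω i) (xrs ω i) = z (xs ω j) (xrs ω j) then 1 else 0)) + 1 / Fintype.card T := by
      intro ω
      have hone : (1 : ℝ) / Fintype.card T
          = ∑ c, W (xs ω i) (xrs ω i) c * (1 / Fintype.card T) := by
        rw [← sum_mul, hW, one_mul]
      rw [hone, ← sum_add_distrib]
      refine sum_le_sum fun c _ => ?_
      rw [← mul_add]
      refine mul_le_mul_of_nonneg_left ?_ (hW0 _ _ _)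
      have hT0 : (0 : ℝ) ≤ 1 / Fintype.card T := by positivity
      by_cases hty : Typ (xs ω j) (xrs ω j) c
      · by_cases hz : z (xs ω i) (xrs ω i) = z (xs ω j) (xrs ω j)
        · have : κ ω i j = 1 := if_pos (by rw [hz, hij])
          rw [if_pos hty, if_pos ⟨hty, hz⟩, this]
          linarith
        · have : κ ω i j = 1 / Fintype.card T :=
            if_neg fun e => hz (Prod.ext_iff.1 e).2.symm
          rw [if_pos hty, if_neg (fun e => hz e.2), this, zero_add]
      · rw [if_neg hty, if_neg (fun e => hty e.1), zero_add]
        exact hT0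
    refine (avg_mono hwt0 h1).trans ?_
    rw [avg_add, avg_const hwt1]
    gcongr
    have h2 := avg_codebook_same_cluster hr hk i.2 hne.symm (fun b a' a =>
      ∑ c, W a b c * (if Typ a' b c ∧ z a b = z a' b then 1 else 0))
    have h3 : ∀ ω : S → B × (M → A), ∑ c, W (xs ω i) (xrs ω i) c * (if Typ (xs ω j) (xrs ω j) c ∧
        z (xs ω i) (xrs ω i) = z (xs ω j) (xrs ω j) then (1 : ℝ) else 0)
        = ∑ c, W ((ω i.2).2 i.1) (ω i.2).1 c * (if Typ ((ω i.2).2 j.1) (ω i.2).1 c ∧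
        z ((ω i.2).2 i.1) (ω i.2).1 = z ((ω i.2).2 j.1) (ω i.2).1 then 1 else 0) := by
      intro ω
      simp only [xs, xrs, hij]
    simp_rw [h3]
    refine h2.le.trans ?_
    exact sum_source_pair_le r k W z v ht hr0 hr hk0 hk hW hW0 hv Typ fun a b c h =>
      ((hTyp a b c).1 h).2
  set X : ℝ := 1 / t + 1 / Fintype.card T with hX
  have hX0 : 0 ≤ X := by positivity
  let g : (S → B × (M → A)) → ℝ := fun ω =>
    ∑ i, (miss ω (φ i) + ∑ j, if j ≠ φ i then pr ω (φ i) j else 0)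
  have hg : avg wt g ≤ K * (e1 + e2 + Fintype.card M * Fintype.card S *
      (1 / (Fintype.card T * t)) + (Fintype.card M - 1) * X) := by
    have hi : ∀ i, avg wt (fun ω => miss ω (φ i) + ∑ j, if j ≠ φ i then pr ω (φ i) j else 0)
        ≤ e1 + e2 + Fintype.card M * Fintype.card S *
      (1 / (Fintype.card T * t)) + (Fintype.card M - 1) * X := by
      intro i
      rw [avg_add wt (fun ω => miss ω (φ i)) (fun ω => ∑ j, if j ≠ φ i then pr ω (φ i) j else 0),
        avg_sum univ wt (fun j ω => if j ≠ φ i then pr ω (φ i) j else 0), add_assoc (e1 + e2)]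
      refine add_le_add (hmiss _) ?_
      -- The cost `1 / (|T| t)` is charged to every `j`, even `φ i`, so that the sum simply counts
      -- all |M| |S| pairs.
      have hj : ∀ j, avg wt (fun ω => if j ≠ φ i then pr ω (φ i) j else 0)
          ≤ 1 / (Fintype.card T * t) + if j.1 ≠ (φ i).1 then (if j.2 = (φ i).2 then X else 0)
            else 0 := by
        intro j
        have hTt : (0 : ℝ) ≤ 1 / (Fintype.card T * t) := by positivity
        by_cases h2 : (φ i).2 = j.2
        · by_cases h1 : (φ i).1 = j.1
          · have : j = φ i := Prod.ext h1.symm h2.symm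
            simp only [this, ne_eq, not_true_eq_false, if_false]
            rw [avg_const hwt1]
            linarith
          · have : j ≠ φ i := fun e => h1 (by rw [e])
            simp only [if_pos this, if_pos (Ne.symm h1), if_pos h2.symm]
            exact (hsame _ _ h2 h1).trans (le_add_of_nonneg_left hTt)
        · have : j ≠ φ i := fun e => h2 (by rw [e])
          simp only [if_pos this, if_neg (Ne.symm h2), ite_self, add_zero]
          exact hdiff _ _ h2
      refine (sum_le_sum fun j _ => hj j).trans (le_of_eq ?_)
      rw [sum_add_distrib]
      congr 1
      · simp [Fintype.card_prod]
      · rw [Fintype.sum_prod_type]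
        have : ∀ m : M, (∑ s : S, if m ≠ (φ i).1 then (if s = (φ i).2 then X else 0) else 0)
            = X - if m = (φ i).1 then X else 0 := by
          intro m
          by_cases h : m = (φ i).1 <;> simp [h]
        simp_rw [this]
        rw [sum_sub_distrib]
        simp
        ring
    refine (avg_sum univ wt (fun i ω => miss ω (φ i) +
      ∑ j, if j ≠ φ i then pr ω (φ i) j else 0)).le.trans ?_
    refine (sum_le_sum fun i _ => hi i).trans (le_of_eq ?_)
    simp only [sum_const, card_univ, Fintype.card_fin, nsmul_eq_mul]
  -- Since `κ` already averages over hash functions, a good codebook can be fixed first and a hash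
  -- function chosen for it afterwards.
  obtain ⟨ω, hω⟩ := exists_le_of_weighted_sum_le wt hwt0 hwt1 g hg
  obtain ⟨F, dec, hF⟩ := exists_hash_decoder (T := T) (fun j => z (xs ω j) (xrs ω j))
    (fun j c => W (xs ω j) (xrs ω j) c) (fun j c => hW0 _ _ c)
    (fun j c => Typ (xs ω j) (xrs ω j) c) φ
  refine ⟨fun s => (ω s).1, fun m s => (ω s).2 m, F, dec, hF.trans (le_trans (le_of_eq ?_) hω)⟩
  refine sum_congr rfl fun i _ => ?_
  simp_rw [mul_add]
  rw [sum_add_distrib]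
  refine congrArg₂ (· + ·) rfl ?_
  simp_rw [mul_sum]
  rw [sum_comm]
  refine sum_congr rfl fun j _ => ?_
  by_cases h : j ≠ φ i
  · rw [if_pos h]
    refine sum_congr rfl fun c _ => ?_
    by_cases hty : Typ (xs ω j) (xrs ω j) c
    · rw [if_pos hty, if_pos ⟨h, hty⟩]
    · rw [if_neg hty, if_neg fun e => hty e.2]
  · rw [if_neg h]
    refine sum_eq_zero fun c _ => ?_
    rw [if_neg fun e => h e.1, mul_zero]

end OneShot

theorem sum_sum_prod {ι A B : Type*} [Fintype ι] [DecidableEq ι] [Fintype A] [Fintype B]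
    (f : ι → B → A → ℝ) :
    ∑ β : ι → B, ∑ α : ι → A, ∏ i, f i (β i) (α i) = ∏ i, ∑ b, ∑ a, f i b a := by
  simp_rw [Fintype.prod_sum]

end FiniteInfo

/-! ### Block codes from i.i.d. letters, with exponential bounds on atypicality. -/

namespace SemidetRelayChannel

open FiniteInfo

variable {X Xr Y Z : Type*} [Fintype X] [Fintype Xr] [Fintype Y]
  {ch : SemidetRelayChannel X Xr Y Z} {p : X × Xr → ℝ}

/-- The conditional pmf of the source input given the relay input. -/
def sourceKernel (p : X × Xr → ℝ) (xr : Xr) (x : X) : ℝ :=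
  if relayLaw p xr = 0 then 1 / Fintype.card X else p (x, xr) / relayLaw p xr

theorem sourceKernel_nonneg (hp : ∀ u, 0 ≤ p u) (xr : Xr) (x : X) : 0 ≤ sourceKernel p xr x := by
  rw [sourceKernel]
  split_ifs
  · positivity
  · exact div_nonneg (hp _) (relayLaw_nonneg hp _)

theorem sum_sourceKernel [Nonempty X] (xr : Xr) : ∑ x, sourceKernel p xr x = 1 := by
  by_cases h : relayLaw p xr = 0
  · simp [sourceKernel, h]
  · simp only [sourceKernel, h, if_false]
    rw [← sum_div]
    exact div_self h

theorem relayLaw_mul_sourceKernel (hp : ∀ u, 0 ≤ p u) (xr : Xr) (x : X) :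
    relayLaw p xr * sourceKernel p xr x = p (x, xr) := by
  by_cases h : relayLaw p xr = 0
  · rw [h, zero_mul]
    exact ((sum_eq_zero_iff_of_nonneg fun x _ => hp (x, xr)).1 h x (mem_univ _)).symm
  · simp only [sourceKernel, h, if_false]
    field_simp

theorem sum_relayLaw (hp : p ∈ stdSimplex ℝ (X × Xr)) : ∑ xr, relayLaw p xr = 1 := by
  rw [← hp.2, Fintype.sum_prod_type_right]
  rfl

open Classical in
/-- The joint law of relay observation and output given the relay input, for the conditional source
input law `sourceKernel`. -/
def kernelLaw (ch : SemidetRelayChannel X Xr Y Z) (p : X × Xr → ℝ) (xr : Xr) (z : Z) (y : Y) : ℝ :=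
  ∑ x, sourceKernel p xr x * if ch.z x xr = z then ch.W x xr y else 0

/-- At relay letters of mass 0, `condLaw` is 0 through division by zero, whereas random coding needs
exact averages under a genuine kernel at every letter. The two agree wherever the relay law has
mass, so the divergence is unaffected. -/
theorem kernelLaw_eq_condLaw {xr : Xr} (h : relayLaw p xr ≠ 0) (z : Z) (y : Y) :
    ch.kernelLaw p xr z y = ch.condLaw p xr z y := by
  classical
  rw [kernelLaw, condLaw, sum_div]
  refine sum_congr rfl fun x _ => ?_
  simp only [sourceKernel, h, if_false]
  split_ifs <;> ring

theorem kernelLaw_pos (hp : ∀ u, 0 ≤ p u) {x : X} {xr : Xr} {y : Y} (h : 0 < p (x, xr))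
    (hW : 0 < ch.W x xr y) : 0 < ch.kernelLaw p xr (ch.z x xr) y := by
  rw [kernelLaw_eq_condLaw (relayLaw_pos hp h).ne']
  exact condLaw_pos hp h hW

theorem divergence_kernelLaw (hp : ∀ u, 0 ≤ p u) :
    (ch.divergence p fun x xr y => ch.kernelLaw p xr (ch.z x xr) y)
      = ch.divergence p fun x xr y => ch.condLaw p xr (ch.z x xr) y := by
  refine sum_congr rfl fun ω _ => ?_
  rcases (hp (ω.1, ω.2.1)).eq_or_lt with h | h
  · simp [jointPmf, ← h]
  · simp only [kernelLaw_eq_condLaw (relayLaw_pos hp h).ne']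

theorem sum_jointPmf_eq (p : X × Xr → ℝ) (G : X → Xr → Y → ℝ) :
    ∑ ω : X × Xr × Y, ch.jointPmf p ω * G ω.1 ω.2.1 ω.2.2
      = ∑ xr, ∑ x, ∑ y, p (x, xr) * ch.W x xr y * G x xr y := by
  rw [Fintype.sum_prod_type, sum_comm (s := (univ : Finset Xr))]
  refine sum_congr rfl fun x _ => ?_
  rw [Fintype.sum_prod_type]
  rfl

theorem sum_jointPmf (hp : p ∈ stdSimplex ℝ (X × Xr)) : ∑ ω, ch.jointPmf p ω = 1 := by
  have := sum_jointPmf_mul (ch := ch) p fun _ => 1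
  simp only [mul_one, ch.W_sum] at this
  rw [this, hp.2]

/-- Over blocks, the likelihood ratio falls exponentially rarely short of its typical size. -/
theorem exists_atypical_le_pow (hp : p ∈ stdSimplex ℝ (X × Xr)) (D : X → Xr → Y → ℝ)
    (hD : ∀ x xr y, 0 < p (x, xr) → 0 < ch.W x xr y → 0 < D x xr y) {a : ℝ}
    (ha : a < ch.divergence p D) :
    ∃ θ : ℝ, 0 ≤ θ ∧ θ < 1 ∧ ∀ b : ℕ,
      ∑ xr : Fin b → Xr, ∑ x : Fin b → X,
        (∏ i, relayLaw p (xr i)) * (∏ i, sourceKernel p (xr i) (x i)) *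
        ∑ y : Fin b → Y, (if ∏ i, ch.W (x i) (xr i) (y i)
            ≤ ((2 : ℝ) ^ a) ^ b * ∏ i, D (x i) (xr i) (y i)
          then ∏ i, ch.W (x i) (xr i) (y i) else 0) ≤ θ ^ b := by
  have hl2 : 0 < Real.log 2 := Real.log_pos (by norm_num)
  set f : X → Xr → Y → ℝ := fun x xr y =>
    Real.log (ch.W x xr y / D x xr y) - a * Real.log 2 with hf
  -- Chernoff bound: `f` is the log-ratio minus its threshold and has positive mean. The atypical
  -- event forces the sum of `f` over the block to be at most 0, so exp(-l Σ f) dominates its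
  -- indicator, and θ is the one-letter moment.
  obtain ⟨l, hl, hlt⟩ := exists_sum_mul_exp_lt_one (ch.jointPmf p) (fun ω => f ω.1 ω.2.1 ω.2.2)
    (jointPmf_nonneg hp.1) (sum_jointPmf hp) (by
      have : ∑ ω, ch.jointPmf p ω * f ω.1 ω.2.1 ω.2.2
          = (ch.divergence p D - a) * Real.log 2 := by
        rw [divergence, sub_mul, sum_mul, ← one_mul (a * Real.log 2), ← sum_jointPmf (ch := ch) hp,
          sum_mul, ← sum_sub_distrib]
        refine sum_congr rfl fun ω _ => ?_
        rw [hf, Real.logb]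
        field_simp
      rw [this]
      exact mul_pos (by linarith) hl2)
  refine ⟨_, sum_nonneg fun ω _ => mul_nonneg (jointPmf_nonneg hp.1 ω) (Real.exp_pos _).le, hlt,
    fun b => ?_⟩
  have hpow : (∑ ω, ch.jointPmf p ω * Real.exp (-(l * f ω.1 ω.2.1 ω.2.2))) ^ b
      = ∑ xr : Fin b → Xr, ∑ x : Fin b → X, ∑ y : Fin b → Y,
        ∏ i, p (x i, xr i) * ch.W (x i) (xr i) (y i) * Real.exp (-(l * f (x i) (xr i) (y i))) := by
    rw [sum_jointPmf_eq p (fun x xr y => Real.exp (-(l * f x xr y)))]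
    simp_rw [fun (xr : Fin b → Xr) (x : Fin b → X) =>
      (Fintype.prod_sum fun (i : Fin b) (y : Y) => p (x i, xr i) * ch.W (x i) (xr i) y *
        Real.exp (-(l * f (x i) (xr i) y))).symm]
    rw [sum_sum_prod fun (_ : Fin b) xr x => ∑ y, p (x, xr) * ch.W x xr y *
      Real.exp (-(l * f x xr y))]
    simp
  rw [hpow]
  refine sum_le_sum fun xr _ => sum_le_sum fun x _ => ?_
  rw [← prod_mul_distrib, mul_sum]
  refine sum_le_sum fun y _ => ?_
  simp_rw [relayLaw_mul_sourceKernel hp.1]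
  have hnn : ∀ i, 0 ≤ p (x i, xr i) * ch.W (x i) (xr i) (y i) := fun i =>
    mul_nonneg (hp.1 _) (ch.W_nonneg _ _ _)
  have hrhs : 0 ≤ ∏ i, p (x i, xr i) * ch.W (x i) (xr i) (y i) *
      Real.exp (-(l * f (x i) (xr i) (y i))) :=
    prod_nonneg fun i _ => mul_nonneg (hnn i) (Real.exp_pos _).le
  split_ifs with hle
  swap
  · rwa [mul_zero]
  rw [← prod_mul_distrib]
  by_cases hz : ∏ i, p (x i, xr i) * ch.W (x i) (xr i) (y i) = 0
  · rwa [hz]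
  have hpos : ∀ i, 0 < p (x i, xr i) * ch.W (x i) (xr i) (y i) := fun i =>
    (hnn i).lt_of_ne' (prod_ne_zero_iff.1 hz i (mem_univ _))
  have hWi : ∀ i, 0 < ch.W (x i) (xr i) (y i) := fun i =>
    pos_of_mul_pos_right (hpos i) (hp.1 _)
  have hDi : ∀ i, 0 < D (x i) (xr i) (y i) := fun i =>
    hD _ _ _ (pos_of_mul_pos_left (hpos i) (hWi i).le) (hWi i)
  rw [prod_mul_distrib (g := fun i => Real.exp (-(l * f (x i) (xr i) (y i))))]
  refine le_mul_of_one_le_right (prod_nonneg fun i _ => hnn i) ?_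
  rw [← Real.exp_sum, sum_neg_distrib, ← mul_sum]
  refine Real.one_le_exp ?_
  rw [neg_nonneg]
  refine mul_nonpos_of_nonneg_of_nonpos hl.le ?_
  have hlog := Real.log_le_log (prod_pos fun i _ => hWi i) hle
  rw [Real.log_mul (by positivity) (prod_pos fun i _ => hDi i).ne',
    Real.log_prod fun i _ => (hWi i).ne', Real.log_prod fun i _ => (hDi i).ne', Real.log_pow,
    Real.log_rpow (by norm_num)] at hlog
  have : ∑ i, f (x i) (xr i) (y i) = ∑ i, Real.log (ch.W (x i) (xr i) (y i))
      - ∑ i, Real.log (D (x i) (xr i) (y i)) - b * (a * Real.log 2) := by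
    rw [hf]
    simp only
    simp_rw [fun i => Real.log_div (hWi i).ne' (hDi i).ne']
    rw [sum_sub_distrib, sum_sub_distrib]
    simp
  rw [this]
  linarith

/-- Random coding for a block of length `b`, at a rate exponent `a` below the rate bound. -/
theorem exists_block_code_of_lt_rateBound [Fintype Z] [Nonempty X]
    (hp : p ∈ stdSimplex ℝ (X × Xr)) {a : ℝ} (ha : a < ch.rateBound p) :
    ∃ θ : ℝ, 0 ≤ θ ∧ θ < 1 ∧ ∀ (b M S T K : ℕ), 0 < M → 0 < S → 0 < T →
      ∀ φ : Fin K → Fin M × Fin S,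
      ∃ (xr : Fin S → Fin b → Xr) (x : Fin M → Fin S → Fin b → X)
        (F : Fin S → (Fin b → Z) → Fin T) (dec : (Fin b → Y) → Fin T → Fin M × Fin S),
        ∑ k, ∑ y : Fin b → Y,
          (if dec y (F (φ k).2 fun i => ch.z (x (φ k).1 (φ k).2 i) (xr (φ k).2 i)) ≠ φ k then
            ∏ i, ch.W (x (φ k).1 (φ k).2 i) (xr (φ k).2 i) (y i) else 0) ≤
        K * (2 * θ ^ b + M * S * (1 / (T * ((2 : ℝ) ^ a) ^ b))
          + (M - 1) * (1 / ((2 : ℝ) ^ a) ^ b + 1 / T)) := by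
  classical
  rw [rateBound_eq_min_divergence hp.1, ← divergence_kernelLaw hp.1, lt_min_iff] at ha
  obtain ⟨θ₁, h10, h11, h1⟩ := exists_atypical_le_pow hp _
    (fun x xr y h hW => outLaw_pos hp.1 h hW) ha.1
  obtain ⟨θ₂, h20, h21, h2⟩ := exists_atypical_le_pow hp _
    (fun x xr y h hW => kernelLaw_pos hp.1 h hW) ha.2
  refine ⟨max θ₁ θ₂, le_max_of_le_left h10, max_lt h11 h21, ?_⟩
  intro b M S T K hM hS hT φ
  have : Nonempty (Fin M) := ⟨⟨0, hM⟩⟩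
  have : Nonempty (Fin S) := ⟨⟨0, hS⟩⟩
  have : Nonempty (Fin T) := ⟨⟨0, hT⟩⟩
  obtain ⟨xr, x, F, dec, h⟩ := exists_block_code (T := Fin T)
    (fun xr : Fin b → Xr => ∏ i, relayLaw p (xr i))
    (fun (xr : Fin b → Xr) (x : Fin b → X) => ∏ i, sourceKernel p (xr i) (x i))
    (fun (x : Fin b → X) (xr : Fin b → Xr) (y : Fin b → Y) => ∏ i, ch.W (x i) (xr i) (y i))
    (fun (x : Fin b → X) (xr : Fin b → Xr) i => ch.z (x i) (xr i))
    (fun y : Fin b → Y => ∏ i, ch.outLaw p (y i))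
    (fun (xr : Fin b → Xr) (z : Fin b → Z) (y : Fin b → Y) =>
      ∏ i, ch.kernelLaw p (xr i) (z i) (y i))
    (t := ((2 : ℝ) ^ a) ^ b) (by positivity)
    (fun xr => prod_nonneg fun i _ => relayLaw_nonneg hp.1 _)
    (sum_prod_eq_one (fun _ => relayLaw p) fun _ => sum_relayLaw hp)
    (fun xr x => prod_nonneg fun i _ => sourceKernel_nonneg hp.1 _ _)
    (fun xr => sum_prod_eq_one (fun i => sourceKernel p (xr i)) fun _ => sum_sourceKernel _)
    (fun x xr y => prod_nonneg fun i _ => ch.W_nonneg _ _ _)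
    (fun x xr => sum_prod_eq_one (fun i => ch.W (x i) (xr i)) fun _ => ch.W_sum _ _)
    (fun y => by
      simp_rw [← prod_mul_distrib, relayLaw_mul_sourceKernel hp.1]
      rw [sum_sum_prod fun (i : Fin b) xr x => p (x, xr) * ch.W x xr (y i)]
      refine prod_congr rfl fun i _ => ?_
      rw [outLaw, Fintype.sum_prod_type_right])
    (fun xr z y => by
      simp_rw [kernelLaw, Fintype.prod_sum]
      refine sum_congr rfl fun x _ => ?_
      rw [prod_mul_distrib, prod_ite_zero]
      simp [funext_iff])
    φ
  refine ⟨xr, x, F, dec, ?_⟩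
  refine le_trans (le_of_eq ?_) (h.trans ?_)
  · refine sum_congr rfl fun k _ => sum_congr rfl fun y _ => ?_
    congr
  · refine mul_le_mul_of_nonneg_left ?_ (by positivity)
    simp only [Fintype.card_fin]
    gcongr
    rw [two_mul]
    refine add_le_add (le_trans (le_of_eq ?_) ((h1 b).trans
      (pow_le_pow_left₀ h10 (le_max_left _ _) b))) (le_trans (le_of_eq ?_) ((h2 b).trans
      (pow_le_pow_left₀ h20 (le_max_right _ _) b)))
    · refine sum_congr rfl fun xr _ => sum_congr rfl fun x _ => congrArg _ ?_
      refine sum_congr rfl fun y _ => ?_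
      congr
    · refine sum_congr rfl fun xr _ => sum_congr rfl fun x _ => congrArg _ ?_
      refine sum_congr rfl fun y _ => ?_
      congr

end SemidetRelayChannel

/-! ### Chaining blocks by backward decoding. -/

namespace SemidetRelayChannel

open FiniteInfo

variable {X Xr Y Z : Type*} [Fintype Y]

/-- The encoders of a relay code for `K` messages together with the observations of the relay. -/
structure Scheme (ch : SemidetRelayChannel X Xr Y Z) (n K : ℕ) where
  enc : Fin K → Fin n → X
  relay : (i : Fin n) → (Fin i.val → Z) → Xr
  obs : Fin K → Fin n → Z
  obs_eq : ∀ k i, obs k i =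
    ch.z (enc k i) (relay i fun j => obs k ⟨j.val, j.isLt.trans i.isLt⟩)

namespace Scheme

variable {ch : SemidetRelayChannel X Xr Y Z} {n K : ℕ}

/-- The symbol sent by the relay. -/
def input (s : Scheme ch n K) (k : Fin K) (i : Fin n) : Xr :=
  s.relay i fun j => s.obs k ⟨j.val, j.isLt.trans i.isLt⟩

/-- The conditional law of the destination's output given the message. -/
def prob (s : Scheme ch n K) (k : Fin K) (y : Fin n → Y) : ℝ :=
  ∏ i, ch.W (s.enc k i) (s.input k i) (y i)

theorem prob_nonneg (s : Scheme ch n K) (k : Fin K) (y : Fin n → Y) : 0 ≤ s.prob k y :=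
  prod_nonneg fun _ _ => ch.W_nonneg _ _ _

theorem sum_prob (s : Scheme ch n K) (k : Fin K) : ∑ y, s.prob k y = 1 :=
  sum_prod_eq_one (fun i => ch.W (s.enc k i) (s.input k i)) fun _ => ch.W_sum _ _

/-- Append a block in which the relay knows a function `hash` of its previous observations. -/
def append (s : Scheme ch n K) {S M : Type*} {b : ℕ} (hash : (Fin n → Z) → S) (μ : Fin K → M)
    (xr : S → Fin b → Xr) (x : M → S → Fin b → X) : Scheme ch (n + b) K where
  enc k := Fin.append (s.enc k) (x (μ k) (hash (s.obs k)))
  relay i past := if h : i.val < n then s.relay ⟨i.val, h⟩ past else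
    xr (hash fun j => past ⟨j.val, by omega⟩) ⟨i.val - n, by omega⟩
  obs k := Fin.append (s.obs k) fun i =>
    ch.z (x (μ k) (hash (s.obs k)) i) (xr (hash (s.obs k)) i)
  obs_eq k i := by
    refine Fin.addCases (fun i => ?_) (fun i => ?_) i
    · rw [Fin.append_left, Fin.append_left, s.obs_eq, dif_pos (by simp)]
      congr 2
      funext j
      exact (Fin.append_left (s.obs k) _ ⟨j.val, j.isLt.trans i.isLt⟩).symm
    · rw [Fin.append_right, Fin.append_right, dif_neg (by simp)]
      congr 2
      · congr 1
        funext j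
        exact (Fin.append_left (s.obs k) _ j).symm
      · ext
        simp

variable {S M : Type*} {b : ℕ} (s : Scheme ch n K) (hash : (Fin n → Z) → S) (μ : Fin K → M)
    (xr : S → Fin b → Xr) (x : M → S → Fin b → X)

theorem append_obs_left (k : Fin K) (i : Fin n) :
    (s.append hash μ xr x).obs k (Fin.castAdd b i) = s.obs k i := by
  simp only [append, Fin.append_left]

theorem append_obs_right (k : Fin K) (i : Fin b) :
    (s.append hash μ xr x).obs k (Fin.natAdd n i) =
      ch.z (x (μ k) (hash (s.obs k)) i) (xr (hash (s.obs k)) i) := by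
  simp only [append, Fin.append_right]

theorem append_input_left (k : Fin K) (i : Fin n) :
    (s.append hash μ xr x).input k (Fin.castAdd b i) = s.input k i := by
  have h : (Fin.castAdd b i).val < n := by simp
  refine (dif_pos h).trans ?_
  refine congrArg (s.relay i) ?_
  funext j
  exact s.append_obs_left hash μ xr x k ⟨j.val, j.isLt.trans i.isLt⟩

theorem append_input_right (k : Fin K) (i : Fin b) :
    (s.append hash μ xr x).input k (Fin.natAdd n i) = xr (hash (s.obs k)) i := by
  have h : ¬ (Fin.natAdd n i).val < n := by simp
  refine (dif_neg h).trans ?_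
  refine congrArg₂ (fun h i => xr (hash h) i) ?_ ?_
  · funext j
    exact s.append_obs_left hash μ xr x k j
  · ext
    simp

theorem append_prob (k : Fin K) (y₁ : Fin n → Y) (y₂ : Fin b → Y) :
    (s.append hash μ xr x).prob k (Fin.append y₁ y₂) = s.prob k y₁ *
      ∏ i, ch.W (x (μ k) (hash (s.obs k)) i) (xr (hash (s.obs k)) i) (y₂ i) := by
  rw [prob, Fin.prod_univ_add]
  congr 1
  · refine prod_congr rfl fun i _ => ?_
    rw [append_input_left, Fin.append_left]
    exact congrArg (fun e => ch.W e _ _) (Fin.append_left _ _ _)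
  · refine prod_congr rfl fun i _ => ?_
    rw [append_input_right, Fin.append_right]
    exact congrArg (fun e => ch.W e _ _) (Fin.append_right _ _ _)

end Scheme

open Classical in
/-- There is a scheme of length `n` for `K` messages from which the part `ψ` of the message can be
recovered with error probability at most `e`, given a hash in `S` of the relay observations. -/
def Recovers (ch : SemidetRelayChannel X Xr Y Z) (n S : ℕ) {K : ℕ} {A : Type*} (ψ : Fin K → A)
    (e : ℝ) : Prop :=
  ∃ (s : Scheme ch n K) (hash : (Fin n → Z) → Fin S) (dec : (Fin n → Y) → Fin S → A),
    ∑ k, ∑ y, (if dec y (hash (s.obs k)) ≠ ψ k then s.prob k y else 0) ≤ K * e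

variable {ch : SemidetRelayChannel X Xr Y Z}

theorem recovers_zero {K : ℕ} : ch.Recovers 0 1 (fun _ : Fin K => ()) 0 :=
  ⟨⟨fun _ => Fin.elim0, fun i => i.elim0, fun _ => Fin.elim0, fun _ i => i.elim0⟩, fun _ => 0,
    fun _ _ => (), by simp⟩

theorem Recovers.mono {n S K : ℕ} {A : Type*} {ψ : Fin K → A} {e e' : ℝ}
    (h : ch.Recovers n S ψ e) (he : e ≤ e') : ch.Recovers n S ψ e' := by
  obtain ⟨s, hash, dec, h⟩ := h
  exact ⟨s, hash, dec, h.trans (by gcongr)⟩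

theorem Recovers.comp {n S K : ℕ} {A A' : Type*} {ψ : Fin K → A} {e : ℝ}
    (h : ch.Recovers n S ψ e) (g : A → A') : ch.Recovers n S (fun k => g (ψ k)) e := by
  classical
  obtain ⟨s, hash, dec, h⟩ := h
  refine ⟨s, hash, fun y t => g (dec y t), le_trans (sum_le_sum fun k _ =>
    sum_le_sum fun y _ => ?_) h⟩
  have := s.prob_nonneg k y
  by_cases hd : dec y (hash (s.obs k)) = ψ k
  · simp [hd]
  · rw [if_pos hd]
    split_ifs
    · exact le_rfl
    · exact this

-- The new block is decoded first, and the state it reveals is the hash that the earlier decoder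
-- needs; a union bound adds the errors. The hypothesis quantifies over all `σ` because the state is
-- a function of the message fixed by the scheme built so far.
open Classical in
theorem Recovers.append {n S K : ℕ} {A : Type*} {ψ : Fin K → A} {e e' : ℝ}
    (h : ch.Recovers n S ψ e) {b M T : ℕ} (μ : Fin K → Fin M)
    (hblock : ∀ σ : Fin K → Fin S, ∃ (xr : Fin S → Fin b → Xr) (x : Fin M → Fin S → Fin b → X)
      (F : Fin S → (Fin b → Z) → Fin T) (dec : (Fin b → Y) → Fin T → Fin M × Fin S),
        ∑ k, ∑ y : Fin b → Y,
          (if dec y (F (σ k) fun i => ch.z (x (μ k) (σ k) i) (xr (σ k) i)) ≠ (μ k, σ k) then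
            ∏ i, ch.W (x (μ k) (σ k) i) (xr (σ k) i) (y i) else 0) ≤ K * e') :
    ch.Recovers (n + b) T (fun k => (ψ k, μ k)) (e + e') := by
  obtain ⟨s, hash, dec, h⟩ := h
  obtain ⟨xr, x, F, decb, hb⟩ := hblock fun k => hash (s.obs k)
  refine ⟨s.append hash μ xr x,
    fun z => F (hash fun i => z (Fin.castAdd b i)) fun i => z (Fin.natAdd n i),
    fun y t => (dec (fun i => y (Fin.castAdd b i)) (decb (fun i => y (Fin.natAdd n i)) t).2,
      (decb (fun i => y (Fin.natAdd n i)) t).1), ?_⟩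
  rw [mul_add]
  refine le_trans ?_ (add_le_add h hb)
  rw [← sum_add_distrib]
  refine sum_le_sum fun k _ => ?_
  set Wb : (Fin b → Y) → ℝ := fun y =>
    ∏ i, ch.W (x (μ k) (hash (s.obs k)) i) (xr (hash (s.obs k)) i) (y i) with hWb
  have hWb0 : ∀ y, 0 ≤ Wb y := fun y => prod_nonneg fun _ _ => ch.W_nonneg _ _ _
  have hWb1 : ∑ y, Wb y = 1 := sum_prod_eq_one
    (fun i => ch.W (x (μ k) (hash (s.obs k)) i) (xr (hash (s.obs k)) i)) fun _ => ch.W_sum _ _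
  rw [← (Fin.appendEquiv n b).sum_comp, Fintype.sum_prod_type]
  have hobs1 : (fun i => (s.append hash μ xr x).obs k (Fin.castAdd b i)) = s.obs k := by
    funext i
    exact s.append_obs_left hash μ xr x k i
  have hobs2 : (fun i => (s.append hash μ xr x).obs k (Fin.natAdd n i)) = fun i =>
      ch.z (x (μ k) (hash (s.obs k)) i) (xr (hash (s.obs k)) i) := by
    funext i
    exact s.append_obs_right hash μ xr x k i
  set τ := F (hash (s.obs k)) fun i => ch.z (x (μ k) (hash (s.obs k)) i) (xr (hash (s.obs k)) i)
  have hl : ∀ (y₁ : Fin n → Y) (y₂ : Fin b → Y),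
      (fun i => Fin.appendEquiv n b (y₁, y₂) (Fin.castAdd b i)) = y₁ := fun y₁ y₂ => by
    funext i
    exact Fin.append_left _ _ _
  have hr : ∀ (y₁ : Fin n → Y) (y₂ : Fin b → Y),
      (fun i => Fin.appendEquiv n b (y₁, y₂) (Fin.natAdd n i)) = y₂ := fun y₁ y₂ => by
    funext i
    exact Fin.append_right _ _ _
  have hpr : ∀ (y₁ : Fin n → Y) (y₂ : Fin b → Y),
      (s.append hash μ xr x).prob k (Fin.appendEquiv n b (y₁, y₂)) = s.prob k y₁ * Wb y₂ :=
    fun y₁ y₂ => s.append_prob hash μ xr x k y₁ y₂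
  simp only [hobs1, hobs2, hl, hr, hpr]
  calc _ ≤ ∑ y₁, ∑ y₂, ((if dec y₁ (hash (s.obs k)) ≠ ψ k then s.prob k y₁ else 0) * Wb y₂
        + s.prob k y₁ * (if decb y₂ τ ≠ (μ k, hash (s.obs k)) then Wb y₂ else 0)) := by
        refine sum_le_sum fun y₁ _ => sum_le_sum fun y₂ _ => ?_
        have h1 := s.prob_nonneg k y₁
        have h2 := hWb0 y₂
        have h3 := mul_nonneg h1 h2
        by_cases hd : decb y₂ τ = (μ k, hash (s.obs k))
        · by_cases hd' : dec y₁ (hash (s.obs k)) = ψ k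
          · simp [τ, hd, hd'] at *
          · rw [if_pos hd', if_neg (not_not.2 hd), mul_zero, add_zero]
            split_ifs
            · exact le_rfl
            · exact h3
        · rw [if_pos hd]
          have : 0 ≤ (if dec y₁ (hash (s.obs k)) ≠ ψ k then s.prob k y₁ else 0) * Wb y₂ :=
            mul_nonneg (by split_ifs <;> simp [h1]) h2
          split_ifs at this ⊢ <;> linarith
    _ = _ := by
        simp_rw [sum_add_distrib, ← mul_sum, ← sum_mul, hWb1, s.sum_prob, mul_one, one_mul]
        rfl

/-- By causality the equation `obs_eq` has only one solution, the recursively defined observations.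
-/
theorem relayObs_eq_obs {n K : ℕ} (s : Scheme ch n K) (dec : (Fin n → Y) → Fin K) (k : Fin K) :
    ∀ (i : ℕ) (hi : i < n), ch.relayObs ⟨s.enc, s.relay, dec⟩ k ⟨i, hi⟩ = s.obs k ⟨i, hi⟩ := by
  intro i
  induction i using Nat.strong_induction_on with
  | _ i ih =>
    intro hi
    rw [relayObs, s.obs_eq]
    refine congrArg (ch.z (s.enc k ⟨i, hi⟩)) (congrArg (s.relay ⟨i, hi⟩) ?_)
    funext j
    exact ih j.val j.isLt _

/-- A hash with a single value carries no information, so the destination needs no help. -/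
theorem Recovers.exists_relayCode {n K : ℕ} (hK : 0 < K) {A : Type*} {ψ : Fin K → A}
    (hψ : Function.Injective ψ) {e : ℝ} (h : ch.Recovers n 1 ψ e) :
    ∃ c : RelayCode X Xr Y Z n K, ch.errorProb c ≤ e := by
  classical
  obtain ⟨s, hash, dec, h⟩ := h
  have : Nonempty (Fin K) := ⟨⟨0, hK⟩⟩
  have hK' : (0 : ℝ) < K := by positivity
  refine ⟨⟨s.enc, s.relay, fun y => Function.invFun ψ (dec y 0)⟩, ?_⟩
  rw [errorProb, div_le_iff₀ hK', mul_comm]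
  refine le_trans (sum_le_sum fun k _ => sum_le_sum fun y _ => ?_) h
  have hprob : ch.outputProb ⟨s.enc, s.relay, fun y => Function.invFun ψ (dec y 0)⟩ k y
      = s.prob k y := by
    refine prod_congr rfl fun i _ => ?_
    refine congrArg (fun e => ch.W (s.enc k i) e (y i)) ?_
    refine congrArg (s.relay i) ?_
    funext j
    exact relayObs_eq_obs s _ k j.val _
  rw [hprob]
  have := s.prob_nonneg k y
  by_cases hd : dec y 0 = ψ k
  · simp only [hd, Function.leftInverse_invFun hψ k, ne_eq, not_true_eq_false, if_false]
    split_ifs <;> simp [this]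
  · have hd' : dec y (hash (s.obs k)) ≠ ψ k := by
      rwa [Subsingleton.elim (hash (s.obs k)) 0]
    rw [if_pos hd']
    split_ifs
    · exact le_rfl
    · exact this

/-! ### Block transmission and choice of parameters. -/

open Filter Topology

variable {X Xr Y Z : Type*} [Fintype Y] {ch : SemidetRelayChannel X Xr Y Z}

open Classical in
/-- For every family of message parts and relay states there is a code for a block of length `b`
that conveys them, given a hash of the next state, with error probability at most `e`. -/
def BlockCodes (ch : SemidetRelayChannel X Xr Y Z) (b K M S T : ℕ) (e : ℝ) : Prop :=
  ∀ φ : Fin K → Fin M × Fin S,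
    ∃ (xr : Fin S → Fin b → Xr) (x : Fin M → Fin S → Fin b → X)
      (F : Fin S → (Fin b → Z) → Fin T) (dec : (Fin b → Y) → Fin T → Fin M × Fin S),
      ∑ k, ∑ y : Fin b → Y,
        (if dec y (F (φ k).2 fun i => ch.z (x (φ k).1 (φ k).2 i) (xr (φ k).2 i)) ≠ φ k then
          ∏ i, ch.W (x (φ k).1 (φ k).2 i) (xr (φ k).2 i) (y i) else 0) ≤ K * e

theorem BlockCodes.trivial [Nonempty X] [Nonempty Xr] (b K : ℕ) :
    ch.BlockCodes b K 1 1 1 0 := fun φ =>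
  ⟨fun _ _ => Classical.arbitrary _, fun _ _ _ => Classical.arbitrary _, fun _ _ => 0,
    fun _ _ => (0, 0), by
      have : ∀ k, ((0, 0) : Fin 1 × Fin 1) = φ k := fun k => Subsingleton.elim _ _
      simp [← this]⟩

theorem Recovers.append_block {n S K : ℕ} {A : Type*} {ψ : Fin K → A} {e e' : ℝ}
    (h : ch.Recovers n S ψ e) {b M T : ℕ} (hb : ch.BlockCodes b K M S T e') (μ : Fin K → Fin M) :
    ch.Recovers (n + b) T (fun k => (ψ k, μ k)) (e + e') :=
  h.append μ fun σ => hb fun k => (μ k, σ k)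

theorem Recovers.append_idle_block {n S K : ℕ} {A : Type*} {ψ : Fin K → A} {e e' : ℝ}
    (h : ch.Recovers n S ψ e) {b T : ℕ} (hb : ch.BlockCodes b K 1 S T e') :
    ch.Recovers (n + b) T ψ (e + e') :=
  (h.append_block hb fun _ => 0).comp Prod.fst

/-- The number of states is existential because it is 1 before the first block and `M * M` after
every block. -/
theorem exists_recovers_blocks {b K M : ℕ} (hM : 0 < M) {e : ℝ}
    (hstep : ∀ S, 0 < S → S ≤ M * M → ch.BlockCodes b K M S (M * M) e) :
    ∀ (B : ℕ) (ψ : Fin K → Fin B → Fin M),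
      ∃ S, 0 < S ∧ S ≤ M * M ∧ ch.Recovers (B * b) S ψ (B * e)
  | 0, ψ => by
    refine ⟨1, one_pos, Nat.mul_pos hM hM, ?_⟩
    have h := (recovers_zero (ch := ch) (K := K)).comp fun _ => (Fin.elim0 : Fin 0 → Fin M)
    have hψ : ψ = fun _ => (Fin.elim0 : Fin 0 → Fin M) := Subsingleton.elim _ _
    rw [hψ, Nat.zero_mul, Nat.cast_zero, zero_mul]
    exact h
  | B + 1, ψ => by
    obtain ⟨S, hS, hSM, h⟩ := exists_recovers_blocks hM hstep B
      fun k => Fin.init (α := fun _ => Fin M) (ψ k)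
    refine ⟨M * M, Nat.mul_pos hM hM, le_rfl, ?_⟩
    have h' := (h.append_block (hstep S hS hSM) fun k => ψ k (Fin.last B)).comp
      fun u => Fin.snoc (α := fun _ => Fin M) u.1 u.2
    have hψ : (fun k => Fin.snoc (α := fun _ => Fin M) (Fin.init (α := fun _ => Fin M) (ψ k))
        (ψ k (Fin.last B))) = ψ := by
      funext k
      exact Fin.snoc_init_self _
    rw [hψ, ← Nat.succ_mul] at h'
    refine h'.mono (le_of_eq ?_)
    push_cast
    ring

/-- Blockwise transmission of `K ≤ M ^ B` messages, with two more blocks to convey the last relay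
state, and `ρ` idle symbols. -/
theorem exists_relayCode_of_blockCodes [Nonempty X] [Nonempty Xr] {b K M B ρ : ℕ} (hM : 0 < M)
    (hK : 0 < K) (hKM : K ≤ M ^ B) {e : ℝ}
    (hstep : ∀ m S T, 0 < m → 0 < S → 0 < T → m * S ≤ M * T → m ≤ M → (m - 1) * M ≤ T →
      ch.BlockCodes b K m S T e) :
    ∃ c : RelayCode X Xr Y Z (B * b + b + b + ρ) K, ch.errorProb c ≤ (B + 2) * e := by
  obtain ⟨ψ⟩ : Nonempty (Fin K ↪ (Fin B → Fin M)) :=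
    Function.Embedding.nonempty_of_card_le (by simpa using hKM)
  obtain ⟨S, hS, hSM, h⟩ := exists_recovers_blocks (ch := ch) hM (fun S hS hSM =>
    hstep M S (M * M) hM hS (Nat.mul_pos hM hM) (Nat.mul_le_mul_left M hSM) le_rfl
      (Nat.mul_le_mul_right M (Nat.sub_le M 1))) B ψ
  -- With one message part, `(m - 1) * M = 0`, and `m * S ≤ M * T` lets an idle block shrink the
  -- state by a factor `M`: from at most `M * M` to `M`, then to 1.
  have h1 := h.append_idle_block (hstep 1 S M one_pos hS hM (by simpa using hSM) hM (by simp))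
  have h2 := h1.append_idle_block (hstep 1 M 1 one_pos hM one_pos (by simp) hM (by simp))
  have h3 := h2.append_idle_block (BlockCodes.trivial ρ K)
  refine (h3.mono (le_of_eq ?_)).exists_relayCode hK ψ.injective
  ring

theorem achievable_of_lt_rateBound [Fintype X] [Fintype Xr] [Fintype Z] [Nonempty X] [Nonempty Xr]
    {p : X × Xr → ℝ} (hp : p ∈ stdSimplex ℝ (X × Xr)) {R : ℝ} (hR0 : 0 ≤ R)
    (hR : R < ch.rateBound p) : ch.Achievable R := by
  refine ⟨hR0, fun ε hε => ?_⟩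
  obtain ⟨R', hRR', hR'⟩ := exists_between hR
  obtain ⟨a, hR'a, ha⟩ := exists_between hR'
  obtain ⟨θ, hθ0, hθ1, hblock⟩ := exists_block_code_of_lt_rateBound hp ha
  -- This pays for the two idle blocks and leaves a surplus of `b` bits. The choice of `b₁` makes it
  -- cover the bit per block lost in rounding `M` and the rate of the leftover symbols.
  obtain ⟨B, hB⟩ := exists_nat_gt ((2 * R + 1) / (R' - R))
  have hBR : (B + 2) * R + 1 ≤ B * R' := by
    rw [div_lt_iff₀ (by linarith)] at hB
    linarith
  set r : ℝ := 2 ^ R' with hr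
  set τ : ℝ := 2 ^ a with hτ
  have hr0 : 0 < r := by positivity
  have hτ0 : 0 < τ := by positivity
  have hr1 : 1 < r := Real.one_lt_rpow (by norm_num) (by linarith)
  have hrτ : r < τ := Real.rpow_lt_rpow_of_exponent_lt (by norm_num) hR'a
  -- The summands bound atypicality, the two terms of size `M / τ ^ b` (wrong state, repeated
  -- observation), and chance collisions of size `1 / M`, where `M ≥ r ^ b / 2`.
  set η : ℕ → ℝ := fun b => 2 * θ ^ b + 2 * (r / τ) ^ b + 2 * r⁻¹ ^ b with hη
  have hlim : Tendsto (fun b => ((B : ℝ) + 2) * η b) atTop (𝓝 0) := by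
    have h1 := tendsto_pow_atTop_nhds_zero_of_lt_one hθ0 hθ1
    have h2 := tendsto_pow_atTop_nhds_zero_of_lt_one (div_nonneg hr0.le hτ0.le)
      ((div_lt_one hτ0).2 hrτ)
    have h3 := tendsto_pow_atTop_nhds_zero_of_lt_one (inv_nonneg.2 hr0.le)
      (inv_lt_one_of_one_lt₀ hr1)
    have := (((h1.const_mul 2).add (h2.const_mul 2)).add (h3.const_mul 2)).const_mul
      ((B : ℝ) + 2)
    simpa [hη] using this
  obtain ⟨b₀, hb₀⟩ := eventually_atTop.1 (hlim.eventually (ge_mem_nhds hε))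
  obtain ⟨b₁, hb₁⟩ := exists_nat_ge ((B : ℝ) + (B + 2) * R)
  refine ⟨(b₀ + b₁) * (B + 2), fun n hn => ?_⟩
  set b := n / (B + 2) with hb
  have hbn : b₀ + b₁ ≤ b := (Nat.le_div_iff_mul_le (by omega)).2 hn
  have hb1 : (B : ℝ) + (B + 2) * R ≤ b := hb₁.trans (by exact_mod_cast (by omega))
  have hndiv : n = B * b + b + b + n % (B + 2) := by
    conv_lhs => rw [← Nat.div_add_mod n (B + 2)]
    rw [← hb]
    ring
  have hnle : (n : ℝ) ≤ (B + 2) * (b + 1) := by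
    have := Nat.mod_lt n (show 0 < B + 2 by omega)
    have : n ≤ (B + 2) * (b + 1) := by nlinarith
    exact_mod_cast this
  set M := ⌊r ^ b⌋₊ with hMdef
  have hMle : (M : ℝ) ≤ r ^ b := Nat.floor_le (by positivity)
  have hM0 : 0 < M := Nat.floor_pos.2 (one_le_pow₀ hr1.le)
  have hM1 : (1 : ℝ) ≤ M := by exact_mod_cast hM0
  have hMge : r ^ b / 2 ≤ M := by
    have := Nat.lt_floor_add_one (r ^ b)
    rw [← hMdef] at this
    linarith
  have hK0 : 0 < ⌊(2 : ℝ) ^ ((n : ℝ) * R)⌋₊ :=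
    Nat.floor_pos.2 (Real.one_le_rpow (by norm_num) (by positivity))
  have hKM : ⌊(2 : ℝ) ^ ((n : ℝ) * R)⌋₊ ≤ M ^ B := by
    have h1 : (2 : ℝ) ^ ((n : ℝ) * R) ≤ (M : ℝ) ^ B := by
      calc (2 : ℝ) ^ ((n : ℝ) * R) ≤ 2 ^ ((b * R' - 1) * B) := by
            refine Real.rpow_le_rpow_of_exponent_le (by norm_num) ?_
            have h2 := mul_le_mul_of_nonneg_right hnle hR0
            have h3 := mul_le_mul_of_nonneg_left hBR (Nat.cast_nonneg (α := ℝ) b)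
            nlinarith
        _ = (r ^ b / 2) ^ B := by
            rw [Real.rpow_mul (by norm_num), Real.rpow_natCast, Real.rpow_sub (by norm_num),
              Real.rpow_one, mul_comm (b : ℝ), Real.rpow_mul (by norm_num), Real.rpow_natCast]
        _ ≤ (M : ℝ) ^ B := pow_le_pow_left₀ (by positivity) hMge B
    have := (Nat.floor_le (by positivity : (0 : ℝ) ≤ 2 ^ ((n : ℝ) * R))).trans h1
    exact_mod_cast this
  have hcode := exists_relayCode_of_blockCodes (ch := ch) (b := b) (ρ := n % (B + 2)) hM0 hK0
    hKM (e := η b) (by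
      intro m S T hm hS hT hmS hmM hmT φ
      obtain ⟨xr, x, F, dec, h⟩ := hblock b m S T _ hm hS hT φ
      refine ⟨xr, x, F, dec, le_trans (le_of_eq ?_) (h.trans ?_)⟩
      · refine sum_congr rfl fun k _ => sum_congr rfl fun y _ => ?_
        congr
      · refine mul_le_mul_of_nonneg_left ?_ (by positivity)
        have hT' : (0 : ℝ) < T := by exact_mod_cast hT
        have hmS' : (m : ℝ) * S ≤ M * T := by exact_mod_cast hmS
        have hmM' : (m : ℝ) ≤ M := by exact_mod_cast hmM
        have hm' : (1 : ℝ) ≤ m := by exact_mod_cast hm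
        have hmT' : ((m : ℝ) - 1) * M ≤ T := by
          have : (((m - 1 : ℕ) : ℝ)) * M ≤ T := by exact_mod_cast hmT
          rwa [Nat.cast_sub hm, Nat.cast_one] at this
        have hMτ : (M : ℝ) / τ ^ b ≤ (r / τ) ^ b := by
          rw [div_pow]
          gcongr
        -- The size constraints enter here: `m * S ≤ M * T` says that the hash resolves all but a
        -- factor `M` of the candidate pairs, and `(m - 1) * M ≤ T` makes chance collisions cost at
        -- most `1 / M`.
        have h1 : (m : ℝ) * S * (1 / (T * τ ^ b)) ≤ (r / τ) ^ b := by
          refine le_trans ?_ hMτ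
          rw [mul_one_div, div_le_div_iff₀ (by positivity) (by positivity)]
          calc (m : ℝ) * S * τ ^ b ≤ M * T * τ ^ b := by gcongr
            _ = M * (T * τ ^ b) := by ring
        have h2 : ((m : ℝ) - 1) * (1 / τ ^ b) ≤ (r / τ) ^ b := by
          refine le_trans ?_ hMτ
          rw [mul_one_div]
          gcongr
          linarith
        have h3 : ((m : ℝ) - 1) * (1 / T) ≤ 2 * r⁻¹ ^ b := by
          calc ((m : ℝ) - 1) * (1 / T) ≤ 1 / M := by
                rw [mul_one_div, div_le_div_iff₀ hT' (by linarith), one_mul]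
                exact hmT'
            _ ≤ 1 / (r ^ b / 2) := by gcongr
            _ = 2 * r⁻¹ ^ b := by rw [inv_pow]; field_simp
        rw [hη]
        simp only
        rw [mul_add]
        linarith)
  rw [← hndiv] at hcode
  obtain ⟨c, hc⟩ := hcode
  exact ⟨c, hc.trans (hb₀ b (by omega))⟩

/-- Needed separately: if the maximum is 0, no nonnegative rate lies strictly below it. -/
theorem achievable_zero [Nonempty X] [Nonempty Xr] : ch.Achievable 0 := by
  refine ⟨le_rfl, fun ε hε => ⟨0, fun n _ => ?_⟩⟩
  have h1 : ⌊(2 : ℝ) ^ ((n : ℝ) * 0)⌋₊ = 1 := by simp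
  rw [h1]
  refine ⟨⟨fun _ _ => Classical.arbitrary _, fun _ _ => Classical.arbitrary _, fun _ => 0⟩, ?_⟩
  refine le_trans (le_of_eq ?_) hε.le
  simp [errorProb, Subsingleton.elim _ (0 : Fin 1)]

end SemidetRelayChannel

end

theorem theorem1 {X Xr Y Z : Type*} [Fintype X] [Fintype Xr] [Fintype Y] [Fintype Z]
    [Nonempty X] [Nonempty Xr] (ch : SemidetRelayChannel X Xr Y Z) :
    IsLUB {R : ℝ | ch.Achievable R} ch.capacity ∧
      IsGreatest {r : ℝ | ∃ p ∈ stdSimplex ℝ (X × Xr), r = ch.rateBound p} ch.capacity := by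
  obtain ⟨p, hp, hmax⟩ := SemidetRelayChannel.exists_isMaxOn_rateBound (ch := ch)
  have hlub : IsLUB {R : ℝ | ch.Achievable R} (ch.rateBound p) := by
    refine ⟨fun R hR => SemidetRelayChannel.le_of_achievable hR hmax, fun u hu => ?_⟩
    have hu0 : 0 ≤ u := hu SemidetRelayChannel.achievable_zero
    by_contra! hlt
    obtain ⟨R, huR, hR⟩ := exists_between hlt
    exact absurd (hu (SemidetRelayChannel.achievable_of_lt_rateBound hp (hu0.trans huR.le) hR))
      (not_le.2 huR)
  have hcap : ch.capacity = ch.rateBound p :=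
    hlub.csSup_eq ⟨0, SemidetRelayChannel.achievable_zero⟩
  rw [hcap]
  refine ⟨hlub, ⟨p, hp, rfl⟩, ?_⟩
  rintro _ ⟨p', hp', rfl⟩
  exact hmax p' hp'
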